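/- Let $M\subset\mathbb{R}^3$ be a closed (compact, without boundary) smooth embedded surface with a parametrization $S$: $S$ is a smooth immersion of an open set $U\subset\mathbb{R}^2$ into $M$ that is open as a map $U\to M$ and restricts to a bijection from a Borel set $\Omega\subset U$ onto $M$. Let $J$ be the Jacobian of $S$, $g=J^TJ$, $\|a\|_g=\|Ja\|_2$, $da=\sqrt{|g|}\,d\omega_1d\omega_2$ on $\Omega$, let $|E|=\int_{S^{-1}(E)\cap\Omega}da$ be the area of $E\subset M$, and $\nabla_g\cdot z=\frac1{\sqrt{|g|}}\sum_i\partial_i(\sqrt{|g|}\,z^i)$. For $u\in L^2(\Omega,da)$ put $$NETV(u)=\sup\Big\{\int_\Omega u\,\nabla_g\cdot z\,da \;:\; z \text{ a } C^1 \text{ tangent field on } M \text{ (written in parameters)},\ \|z\|_g\le 1\Big\},$$ $$\partial NETV(u)=\Big\{p\in L^2(da) : \textstyle\int_\Omega p\,v\,da\le NETV(v)\ \forall v\in L^2(da),\ NETV(u)=\int_\Omega p\,u\,da\Big\}.$$ A function $u$ is an eigenfunction if there are $\lambda\in\mathbb{R}$ and an integrable tangent field $\xi$ with $\lambda u\in\partial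 NETV(u)$ and $\nabla_g\cdot\xi=\lambda u$ weakly, i.e. $\int_\Omega\langle\xi,\nabla_g\varphi\rangle_g\,da=-\int_\Omega\lambda u\,\varphi\,da$ for all smooth $\varphi$ on $M$. For $C\subset M$ let $\tilde\chi^C$ be the indicator function of $S^{-1}(C)$, $NETV(C)=NETV(\tilde\chi^C)$, let $\partial C$ be the boundary of $C$ in $M$ and $per(C)$ its length. $C$ has smooth boundary if near each point of $\partial C$ there is a smooth function $h$ on a neighbourhood of that point in $M$, vanishing at that point with $dh\neq0$ there, such that in that neighbourhood $\{h<0\}\subset C\subset\{h\le0\}$. $C$ is an eigenset if $\tilde\chi^C-\beta\tilde\chi^{M\setminus C}$ is an eigenfunction for some $\beta>0$. A set $C$ with smooth boundary is a locally minimal perimeter set if $\partial C\ne\emptyset$ and $per(C)\le\frac{|M\setminus C|}{|M\setminus D|}\,per(D)$ for all $D\supseteq C$ in $M$ with smooth boundary and $|M\setminus D|>0$. Corollary. Let $C\subset M$ be an eigenset with smooth boundary. Then $per(C)=NETV(C)$, and for every $D\supseteq C$ in $M$ with smooth boundary and $|M\setminus D|>0$, $$per(C)=NETV(C)\le\frac{|M\setminus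 C|}{|M\setminus D|}\,NETV(D)=\frac{|M\setminus C|}{|M\setminus D|}\,per(D).$$ In particular, if $\partial C\neq\emptyset$, then $C$ is a locally minimal perimeter set. -/

import Mathlib

open MeasureTheory
open scoped ContDiff

/-- The parameter plane, with coordinates `ω₁, ω₂`. -/
abbrev ParamPlane : Type := EuclideanSpace ℝ (Fin 2)

/-- The ambient space `ℝ³`. -/
abbrev AmbientSpace : Type := EuclideanSpace ℝ (Fin 3)

/-- A closed (compact, without boundary) smooth surface in `ℝ³` together with a parametrization.
`S` is a smooth immersion of an open set `U ⊇ Ω` of the plane, it maps `U` into `M = S(Ω)`, and it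
is a bijection from `Ω` onto `M`. The parameter domain `Ω` is any Borel set; for the torus one takes
`Ω = [-π, π) × [-π, π)` and `U = ℝ²`. The last field (`S` is an open map from `U` to `M`) says
that the restrictions of `S` to small open sets are local parametrizations of `M` in the
usual sense, so that `M` is an embedded surface without boundary (self-intersections and
edges are excluded). -/
structure ClosedParametricSurface where
  /-- the parameter domain -/
  Ω : Set ParamPlane
  /-- an open set containing `Ω` on which `S` is a smooth immersion into the surface -/
  U : Set ParamPlane
  /-- the parametrization -/
  S : ParamPlane → AmbientSpace
  measurableSet_Ω : MeasurableSet Ω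
  isOpen_U : IsOpen U
  Ω_subset_U : Ω ⊆ U
  smooth : ContDiffOn ℝ ∞ S U
  immersion : ∀ x ∈ U, Function.Injective (fderiv ℝ S x)
  mapsTo : Set.MapsTo S U (S '' Ω)
  injOn : Set.InjOn S Ω
  isCompact_image : IsCompact (S '' Ω)
  isOpen_image : ∀ V ⊆ U, IsOpen V → ∃ W : Set AmbientSpace, IsOpen W ∧ S '' V = (S '' Ω) ∩ W

namespace ClosedParametricSurface

noncomputable section

variable (X : ClosedParametricSurface)

/-- The surface `M = S(Ω) ⊆ ℝ³`. -/
def M : Set AmbientSpace := X.S '' X.Ω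

/-- The Jacobian `J(ω)`, with columns `S_{ω₁}, S_{ω₂}`, as a linear map `ℝ² → ℝ³`. -/
def J (x : ParamPlane) : ParamPlane →L[ℝ] AmbientSpace := fderiv ℝ X.S x

/-- The `i`-th standard basis vector of the parameter plane. -/
def stdVec (i : Fin 2) : ParamPlane := EuclideanSpace.single i 1

/-- The metric `g = Jᵀ J`. -/
def g (x : ParamPlane) : Matrix (Fin 2) (Fin 2) ℝ :=
  Matrix.of fun i j => inner ℝ (X.J x (stdVec i)) (X.J x (stdVec j))

/-- `√|g|`, the density of the area element. -/
def sqrtDet (x : ParamPlane) : ℝ := Real.sqrt (X.g x).det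

/-- The norm `‖a‖_g = ‖J a‖₂` of a vector `a` originating from `x`. -/
def normG (x a : ParamPlane) : ℝ := ‖X.J x a‖

/-- The area measure `da = √|g| dω₁ dω₂` on `Ω`. -/
def da : Measure ParamPlane :=
  (volume.restrict X.Ω).withDensity fun x => ENNReal.ofReal (X.sqrtDet x)

/-- The area `|E|` of a subset `E` of the surface. -/
def area (E : Set AmbientSpace) : ENNReal := X.da (X.S ⁻¹' E)

/-- The divergence `∇_g · z = (1 / √|g|) ∑ᵢ ∂ᵢ (√|g| zⁱ)`. -/
def div (z : ParamPlane → ParamPlane) (x : ParamPlane) : ℝ :=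
  (X.sqrtDet x)⁻¹ * ∑ i : Fin 2, fderiv ℝ (fun y => X.sqrtDet y * z y i) x (stdVec i)

/-- `z` is a continuously differentiable tangent field on `M`, written in the parameter domain: it
is `C¹`, and at parameters of the same point of `M` it represents the same tangent vector `J z`.
As `M` is compact, the support is automatically compact in `M`. -/
structure IsField (z : ParamPlane → ParamPlane) : Prop where
  contDiffOn : ContDiffOn ℝ 1 z X.U
  compatible : ∀ x ∈ X.U, ∀ y ∈ X.U, X.S x = X.S y → X.J x (z x) = X.J y (z y)

/-- `φ` is a smooth function on `M`, written in the parameter domain. -/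
structure IsSmoothFunction (φ : ParamPlane → ℝ) : Prop where
  contDiffOn : ContDiffOn ℝ ∞ φ X.U
  compatible : ∀ x ∈ X.U, ∀ y ∈ X.U, X.S x = X.S y → φ x = φ y

/-- The non-Euclidean total variation
`NETV(u) = sup { ∫_Ω u ∇_g · z da : z a field with ‖z‖_g ≤ 1 everywhere }`. -/
def NETV (u : ParamPlane → ℝ) : EReal :=
  ⨆ z ∈ {z : ParamPlane → ParamPlane | X.IsField z ∧ ∀ x ∈ X.U, X.normG x (z x) ≤ 1},
    ((∫ x, u x * X.div z x ∂X.da : ℝ) : EReal)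

/-- `p ∈ ∂NETV(u)`, the subdifferential in `L²(M)`: `NETV(v) ≥ ∫ p v da` for all `v ∈ L²(M)`, and
`NETV(u) = ∫ p u da`. -/
structure IsSubgradient (p u : ParamPlane → ℝ) : Prop where
  memLp : MemLp p 2 X.da
  le_NETV : ∀ v : ParamPlane → ℝ, MemLp v 2 X.da →
    ((∫ x, p x * v x ∂X.da : ℝ) : EReal) ≤ X.NETV v
  eq_NETV : X.NETV u = ((∫ x, p x * u x ∂X.da : ℝ) : EReal)

/-- `∇_g · ξ = w` in the weak sense, for an integrable tangent field `ξ` that need not be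
differentiable: `∫ ⟨ξ, ∇_g φ⟩_g da = - ∫ w φ da` for all smooth `φ` on `M`. Here
`⟨ξ, ∇_g φ⟩_g = dφ(ξ)` by definition of the gradient. -/
structure HasWeakDiv (ξ : ParamPlane → ParamPlane) (w : ParamPlane → ℝ) : Prop where
  integrable : Integrable (fun x => X.J x (ξ x)) X.da
  integral_eq : ∀ φ : ParamPlane → ℝ, X.IsSmoothFunction φ →
    ∫ x, fderiv ℝ φ x (ξ x) ∂X.da = - ∫ x, w x * φ x ∂X.da

/-- `u` is an eigenfunction of `NETV`: for some real `lam` and some field `ξ`,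
`lam u ∈ ∂NETV(u)` and `∇_g · ξ = lam u`. -/
def IsEigenfunction (u : ParamPlane → ℝ) : Prop :=
  ∃ (lam : ℝ) (ξ : ParamPlane → ParamPlane),
    X.IsSubgradient (fun x => lam * u x) u ∧ X.HasWeakDiv ξ (fun x => lam * u x)

/-- The indicator function of `C ⊆ M`, written in the parameter domain. -/
def chi (C : Set AmbientSpace) (x : ParamPlane) : ℝ := C.indicator (fun _ => (1 : ℝ)) (X.S x)

/-- `C` is an eigenset: `χ^C - β χ^{M ∖ C}` is an eigenfunction for some `β > 0`. -/
def IsEigenset (C : Set AmbientSpace) : Prop :=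
  ∃ β : ℝ, 0 < β ∧ X.IsEigenfunction fun x => X.chi C x - β * X.chi (X.M \ C) x

/-- The boundary `∂C` of `C ⊆ M` relative to `M`. -/
def boundary (C : Set AmbientSpace) : Set AmbientSpace := closure C ∩ closure (X.M \ C)

/-- `C` is a subset of `M` with smooth boundary: near each of its boundary points, `C` is
given (up to boundary points) by `h < 0` for a smooth function `h` with nonzero differential.
Both `C` and its complement in `M` may be open, closed or neither. -/
structure HasSmoothBoundary (C : Set AmbientSpace) : Prop where
  subset : C ⊆ X.M
  exists_defining : ∀ x ∈ X.U, X.S x ∈ X.boundary C →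
    ∃ (V : Set ParamPlane) (h : ParamPlane → ℝ), IsOpen V ∧ x ∈ V ∧ V ⊆ X.U ∧
      ContDiffOn ℝ ∞ h V ∧ h x = 0 ∧ fderiv ℝ h x ≠ 0 ∧
      ∀ y ∈ V, (h y < 0 → X.S y ∈ C) ∧ (0 < h y → X.S y ∉ C)

/-- The perimeter of `C`: the length (one-dimensional Hausdorff measure in `ℝ³`) of `∂C`. -/
def per (C : Set AmbientSpace) : ENNReal := Measure.hausdorffMeasure 1 (X.boundary C)

/-- `C` is a locally minimal perimeter set: `∂C` is nonempty and
`per(C) ≤ (|M ∖ C| / |M ∖ D|) per(D)` for all sets `D ⊇ C` with smooth boundary (for which the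
quotient makes sense). -/
def IsLocallyMinimalPerimeterSet (C : Set AmbientSpace) : Prop :=
  (X.boundary C).Nonempty ∧
    ∀ D : Set AmbientSpace, X.HasSmoothBoundary D → C ⊆ D → 0 < X.area (X.M \ D) →
      X.per C ≤ X.area (X.M \ C) / X.area (X.M \ D) * X.per D

end

end ClosedParametricSurface

/-!
The total variation of the indicator function of a set `D` with smooth boundary is the length of
`∂D`, and the statement about eigensets is algebra on top of that.

**Total variation equals length.** Around every point of the surface there are coordinates in which
`D` is the half-plane where the first coordinate is negative (`AdaptedChart`,
`HasSmoothBoundary.exists_adaptedChart`). The given parameters and such coordinates are related by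
a local diffeomorphism `T`, injective on `Ω`, so that areas transform by the change of variables
formula and divergences by the Piola identity (`planeDiv_cof_comp`,
`AdaptedChart.planeDiv_sqrtDet_smul`). For a field supported in one chart, the integral of its
divergence over `D` is therefore its flux through the line where the first coordinate vanishes
(`AdaptedChart.integral_chi_mul_div`). A partition of unity gives the divergence theorem on `D` for
all `C¹` fields (`AdaptedPartition.integral_chi_mul_div`).

The boundary flux of a field of norm at most one is at most the length of the boundary. Equality
holds for a field that restricts to the outer unit conormal on `∂D`; it is glued from the
normalized gradients of the first coordinates of the charts, which agree on `∂D`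
(`AdaptedChart.conormalField_eq`). The length computed in the charts is the one-dimensional
Hausdorff measure by the area formula for injective regular curves
(`hausdorffMeasure_image_eq_lintegral_speed`). Together this is `HasSmoothBoundary.NETV_chi`.

**Eigensets.** For `D = M` the boundary is empty, so divergences of admissible fields have integral
zero, and `NETV (χ^C - β χ^{M ∖ C}) = (1 + β) NETV (χ^C)`. The mean of an eigenfunction with nonzero
eigenvalue `λ` vanishes, that is `|C| = β |M ∖ C|`, whence `per C = λ β |M ∖ C|`. The subgradient
inequality at `χ^D` with `D ⊇ C` reads `λ β |M ∖ D| ≤ NETV (χ^D) = per D`; comparing the two gives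
the claim (`IsEigenset.per_le`). For `λ = 0` the perimeter of `C` vanishes.
-/

/-! ### Length of regular curves -/

open Filter Topology NNReal in
/-- Near a point where the velocity does not vanish, a `C¹` curve is, up to any prescribed factor
`K > 1`, a similarity whose ratio is its speed. -/
lemma exists_nhds_almost_similarity {E : Type*} [NormedAddCommGroup E] [NormedSpace ℝ E]
    {γ : ℝ → E} {t₀ : ℝ} (hγ : ContDiffAt ℝ 1 γ t₀) (h0 : deriv γ t₀ ≠ 0) {K : ℝ} (hK : 1 < K) :
    ∃ N ∈ 𝓝 t₀, ∃ c : ℝ, 0 < c ∧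
      (∀ s ∈ N, ∀ t ∈ N, c / K * dist s t ≤ dist (γ s) (γ t) ∧
        dist (γ s) (γ t) ≤ c * K * dist s t) ∧
      ∀ t ∈ N, c / K ≤ ‖deriv γ t‖ ∧ ‖deriv γ t‖ ≤ c * K := by
  have hK0 : 0 < K := by linarith
  set c := ‖deriv γ t₀‖ with hc
  have hcpos : 0 < c := norm_pos_iff.2 h0
  -- the error bound for which `c - δ = c / K` and `c + δ ≤ c * K`
  set δ := c * (1 - 1 / K) with hδ
  have hinv : 1 / K < 1 := by rw [div_lt_one hK0]; exact hK
  have hδpos : 0 < δ := mul_pos hcpos (by linarith)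
  have e1 : c - δ = c / K := by rw [hδ]; ring
  have e2 : c + δ ≤ c * K := by
    have : 2 - 1 / K ≤ K := by
      have h1 : K * (1 / K) = 1 := by field_simp
      nlinarith [sq_nonneg (K - 1)]
    rw [hδ]; nlinarith
  have hs : HasStrictDerivAt γ (deriv γ t₀) t₀ := hγ.hasStrictDerivAt (by norm_num)
  have h1 := hs.isLittleO.def hδpos
  rw [nhds_prod_eq, eventually_prod_self_iff'] at h1
  obtain ⟨N₁, hN₁, h1⟩ := h1
  have hcont : ContinuousAt (deriv γ) t₀ := by
    have h2 := hγ.continuousAt_fderiv (by norm_num)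
    have : deriv γ = fun t => fderiv ℝ γ t 1 := by ext t; simp
    rw [this]
    exact h2.clm_apply continuousAt_const
  have h3 : ∀ᶠ t in 𝓝 t₀, dist (deriv γ t) (deriv γ t₀) < δ := Metric.tendsto_nhds.1 hcont δ hδpos
  refine ⟨N₁ ∩ {t | dist (deriv γ t) (deriv γ t₀) < δ}, inter_mem hN₁ h3, c, hcpos, ?_, ?_⟩
  · rintro s ⟨hs, -⟩ t ⟨ht, -⟩
    have h4 : ‖γ s - γ t - (s - t) • deriv γ t₀‖ ≤ δ * ‖s - t‖ := by
      simpa using h1 s hs t ht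
    have h5 : ‖(s - t) • deriv γ t₀‖ = ‖s - t‖ * c := norm_smul _ _
    rw [dist_eq_norm, dist_eq_norm, ← e1]
    constructor
    · have := norm_sub_norm_le ((s - t) • deriv γ t₀) (γ s - γ t)
      rw [norm_sub_rev _ (γ s - γ t)] at this
      nlinarith
    · have := norm_sub_norm_le (γ s - γ t) ((s - t) • deriv γ t₀)
      nlinarith [norm_nonneg (s - t)]
  · rintro t ⟨-, ht⟩
    rw [Set.mem_ofPred_eq, dist_eq_norm] at ht
    have h6 := abs_norm_sub_norm_le (deriv γ t) (deriv γ t₀)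
    rw [abs_le] at h6
    rw [← e1]
    constructor <;> linarith

open ENNReal NNReal in
/-- On a set where a curve is a similarity up to a factor `K`, the length of the image and the
integral of the speed agree up to the factor `K ^ 2`. -/
lemma hausdorffMeasure_image_almost_similarity {E : Type*} [NormedAddCommGroup E]
    [NormedSpace ℝ E] [MeasurableSpace E] [BorelSpace E] {γ : ℝ → E} {N : Set ℝ} {K c : ℝ}
    (hK : 1 < K) (hc : 0 < c)
    (hd : ∀ s ∈ N, ∀ t ∈ N, c / K * dist s t ≤ dist (γ s) (γ t) ∧
        dist (γ s) (γ t) ≤ c * K * dist s t)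
    (hn : ∀ t ∈ N, c / K ≤ ‖deriv γ t‖ ∧ ‖deriv γ t‖ ≤ c * K)
    (hN : MeasurableSet N) :
    μH[1] (γ '' N) ≤ ENNReal.ofReal (K ^ 2) * ∫⁻ t in N, ‖deriv γ t‖ₑ ∧
      ∫⁻ t in N, ‖deriv γ t‖ₑ ≤ ENNReal.ofReal (K ^ 2) * μH[1] (γ '' N) := by
  have hK0 : 0 < K := by linarith
  have hen : ∀ t, ‖deriv γ t‖ₑ = ENNReal.ofReal ‖deriv γ t‖ := fun t => (ofReal_norm _).symm
  have hup : μH[1] (γ '' N) ≤ ENNReal.ofReal (c * K) * volume N := by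
    have hL : LipschitzOnWith (Real.toNNReal (c * K)) γ N := by
      refine LipschitzOnWith.of_dist_le_mul fun s hs t ht => ?_
      rw [Real.coe_toNNReal _ (by positivity)]
      exact (hd s hs t ht).2
    have := hL.hausdorffMeasure_image_le (d := 1) zero_le_one
    rwa [hausdorffMeasure_real, ENNReal.rpow_one] at this
  have hlo : ENNReal.ofReal (c / K) * volume N ≤ μH[1] (γ '' N) := by
    have hinj : Set.InjOn γ N := by
      intro s hs t ht hst
      have := (hd s hs t ht).1
      rw [hst, dist_self] at this
      have h2 : 0 < c / K := by positivity
      exact dist_le_zero.1 (nonpos_of_mul_nonpos_right this h2)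
    -- the inverse of the curve is Lipschitz on the image
    have hL : LipschitzOnWith (Real.toNNReal (K / c)) (Function.invFunOn γ N) (γ '' N) := by
      refine LipschitzOnWith.of_dist_le_mul ?_
      rintro _ ⟨s, hs, rfl⟩ _ ⟨t, ht, rfl⟩
      rw [Real.coe_toNNReal _ (by positivity), hinj.leftInvOn_invFunOn hs,
        hinj.leftInvOn_invFunOn ht, div_mul_eq_mul_div, le_div_iff₀ hc]
      have := (hd s hs t ht).1
      rw [div_mul_eq_mul_div, div_le_iff₀ hK0] at this
      linarith
    have := hL.hausdorffMeasure_image_le (d := 1) zero_le_one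
    rw [hinj.leftInvOn_invFunOn.image_image, hausdorffMeasure_real, ENNReal.rpow_one] at this
    calc ENNReal.ofReal (c / K) * volume N
        ≤ ENNReal.ofReal (c / K) * (ENNReal.ofReal (K / c) * μH[1] (γ '' N)) := by
          gcongr; exact this
      _ = μH[1] (γ '' N) := by
        rw [← mul_assoc, ← ENNReal.ofReal_mul (by positivity)]
        have : c / K * (K / c) = 1 := by field_simp
        rw [this, ENNReal.ofReal_one, one_mul]
  have hIlo : ENNReal.ofReal (c / K) * volume N ≤ ∫⁻ t in N, ‖deriv γ t‖ₑ := by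
    rw [← setLIntegral_const]
    refine setLIntegral_mono' hN fun t ht => ?_
    rw [hen]; exact ENNReal.ofReal_le_ofReal (hn t ht).1
  have hIup : ∫⁻ t in N, ‖deriv γ t‖ₑ ≤ ENNReal.ofReal (c * K) * volume N := by
    rw [← setLIntegral_const]
    refine setLIntegral_mono' hN fun t ht => ?_
    rw [hen]; exact ENNReal.ofReal_le_ofReal (hn t ht).2
  have hprod : ENNReal.ofReal (c * K) * volume N
      = ENNReal.ofReal (K ^ 2) * (ENNReal.ofReal (c / K) * volume N) := by
    rw [← mul_assoc, ← ENNReal.ofReal_mul (by positivity)]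
    congr 2; field_simp
  constructor
  · exact (hup.trans_eq hprod).trans (by gcongr)
  · exact (hIup.trans_eq hprod).trans (by gcongr)

open Filter Topology ENNReal NNReal in
/-- The length of an injective regular `C¹` curve is the integral of its speed. The set is cut
into countably many pieces on which the curve is nearly a similarity. -/
lemma hausdorffMeasure_image_eq_lintegral_speed {E : Type*} [NormedAddCommGroup E]
    [NormedSpace ℝ E] [MeasurableSpace E] [BorelSpace E] {γ : ℝ → E} {I s : Set ℝ}
    (hI : IsOpen I) (hγ : ContDiffOn ℝ 1 γ I) (h0 : ∀ t ∈ I, deriv γ t ≠ 0)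
    (hinj : Set.InjOn γ I) (hs : MeasurableSet s) (hsI : s ⊆ I) :
    μH[1] (γ '' s) = ∫⁻ t in s, ‖deriv γ t‖ₑ := by
  have key : ∀ K : ℝ, 1 < K →
      μH[1] (γ '' s) ≤ ENNReal.ofReal (K ^ 2) * ∫⁻ t in s, ‖deriv γ t‖ₑ ∧
      ∫⁻ t in s, ‖deriv γ t‖ₑ ≤ ENNReal.ofReal (K ^ 2) * μH[1] (γ '' s) := by
    intro K hK
    have hex : ∀ t : I, ∃ N : Set ℝ, IsOpen N ∧ t.1 ∈ N ∧ ∃ c : ℝ, 0 < c ∧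
      (∀ s ∈ N, ∀ t ∈ N, c / K * dist s t ≤ dist (γ s) (γ t) ∧
        dist (γ s) (γ t) ≤ c * K * dist s t) ∧
      ∀ t ∈ N, c / K ≤ ‖deriv γ t‖ ∧ ‖deriv γ t‖ ≤ c * K := by
      intro t
      obtain ⟨N, hN, c, hc, h1, h2⟩ := exists_nhds_almost_similarity
        (hγ.contDiffAt (hI.mem_nhds t.2)) (h0 t t.2) hK
      obtain ⟨N', hN', hN'o, hN't⟩ := mem_nhds_iff.1 hN
      exact ⟨N', hN'o, hN't, c, hc, fun s hs t ht => h1 s (hN' hs) t (hN' ht),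
        fun t ht => h2 t (hN' ht)⟩
    choose N hNo hNt hN using hex
    obtain ⟨T, hTc, hTU⟩ := TopologicalSpace.isOpen_iUnion_countable N hNo
    have hcov : I ⊆ ⋃ i ∈ T, N i := by
      rw [hTU]; exact fun t ht => Set.mem_iUnion.2 ⟨⟨t, ht⟩, hNt _⟩
    rcases I.eq_empty_or_nonempty with hIe | ⟨t₁, ht₁⟩
    · have : s = ∅ := Set.subset_eq_empty hsI hIe
      subst this; simp
    have hTne : T.Nonempty := by
      obtain ⟨i, hi, -⟩ := Set.mem_iUnion₂.1 (hcov ht₁)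
      exact ⟨i, hi⟩
    obtain ⟨f, hf⟩ := hTc.exists_eq_range hTne
    set A : ℕ → Set ℝ := fun n => s ∩ disjointed (fun n => N (f n)) n with hA
    have hAm : ∀ n, MeasurableSet (A n) := fun n =>
      hs.inter (MeasurableSet.disjointed (fun n => (hNo _).measurableSet) n)
    have hAd : Pairwise (Function.onFun Disjoint A) := fun i j hij =>
      (disjoint_disjointed _ hij).mono Set.inter_subset_right Set.inter_subset_right
    have hAU : s = ⋃ n, A n := by
      rw [hA, ← Set.inter_iUnion, iUnion_disjointed, eq_comm, Set.inter_eq_left]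
      intro t ht
      obtain ⟨i, hi, hti⟩ := Set.mem_iUnion₂.1 (hcov (hsI ht))
      rw [hf] at hi
      obtain ⟨n, rfl⟩ := hi
      exact Set.mem_iUnion.2 ⟨n, hti⟩
    have hAs : ∀ n, A n ⊆ s := fun n => Set.inter_subset_left
    have hAN : ∀ n, A n ⊆ N (f n) := fun n => Set.inter_subset_right.trans (disjointed_subset _ _)
    have hpiece : ∀ n, μH[1] (γ '' A n) ≤ ENNReal.ofReal (K ^ 2) * ∫⁻ t in A n, ‖deriv γ t‖ₑ ∧
      ∫⁻ t in A n, ‖deriv γ t‖ₑ ≤ ENNReal.ofReal (K ^ 2) * μH[1] (γ '' A n) := by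
      intro n
      obtain ⟨c, hc, h1, h2⟩ := hN (f n)
      exact hausdorffMeasure_image_almost_similarity hK hc
        (fun s hs t ht => h1 s (hAN n hs) t (hAN n ht)) (fun t ht => h2 t (hAN n ht)) (hAm n)
    have hsum1 : ∫⁻ t in s, ‖deriv γ t‖ₑ = ∑' n, ∫⁻ t in A n, ‖deriv γ t‖ₑ := by
      conv_lhs => rw [hAU]
      exact lintegral_iUnion hAm hAd _
    have hsum2 : μH[1] (γ '' s) = ∑' n, μH[1] (γ '' A n) := by
      conv_lhs => rw [hAU, Set.image_iUnion]
      refine measure_iUnion (fun i j hij => ?_) fun n => ?_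
      · exact Set.disjoint_image_image fun x hx y hy hxy =>
          Set.disjoint_left.1 (hAd hij) hx
            (hinj (hsI (hAs i hx)) (hsI (hAs j hy)) hxy ▸ hy)
      · exact (hAm n).image_of_continuousOn_injOn
          (hγ.continuousOn.mono ((hAs n).trans hsI)) (hinj.mono ((hAs n).trans hsI))
    rw [hsum1, hsum2, ← ENNReal.tsum_mul_left, ← ENNReal.tsum_mul_left]
    exact ⟨ENNReal.tsum_le_tsum fun n => (hpiece n).1, ENNReal.tsum_le_tsum fun n => (hpiece n).2⟩
  -- let `K` tend to `1`
  have lim : ∀ a b : ℝ≥0∞, (∀ K : ℝ, 1 < K → a ≤ ENNReal.ofReal (K ^ 2) * b) → a ≤ b := by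
    intro a b hab
    have h1 : Tendsto (fun K : ℝ => ENNReal.ofReal (K ^ 2) * b) (𝓝[>] 1) (𝓝 (1 * b)) := by
      refine ENNReal.Tendsto.mul_const ?_ (Or.inl one_ne_zero)
      have : Tendsto (fun K : ℝ => ENNReal.ofReal (K ^ 2)) (𝓝 1) (𝓝 (ENNReal.ofReal (1 ^ 2))) :=
        ENNReal.tendsto_ofReal ((continuous_pow 2).tendsto 1)
      simpa using this.mono_left nhdsWithin_le_nhds
    rw [one_mul] at h1
    exact ge_of_tendsto h1 (eventually_nhdsWithin_of_forall fun K hK => hab K hK)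
  exact le_antisymm (lim _ _ fun K hK => (key K hK).1) (lim _ _ fun K hK => (key K hK).2)

open ENNReal in
/-- Integration along an injective regular `C¹` curve with respect to arc length. -/
lemma lintegral_hausdorffMeasure_image_curve {E : Type*} [NormedAddCommGroup E]
    [NormedSpace ℝ E] [CompleteSpace E] [MeasurableSpace E] [BorelSpace E] {γ : ℝ → E} {I : Set ℝ}
    (hI : IsOpen I) (hγ : ContDiffOn ℝ 1 γ I) (h0 : ∀ t ∈ I, deriv γ t ≠ 0)
    (hinj : Set.InjOn γ I) {f : E → ℝ≥0∞} (hf : Measurable f) :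
    ∫⁻ p in γ '' I, f p ∂μH[1] = ∫⁻ t in I, f (γ t) * ‖deriv γ t‖ₑ := by
  have hγm : AEMeasurable γ (volume.restrict I) :=
    hγ.continuousOn.aemeasurable hI.measurableSet
  have hdm : Measurable fun t => ‖deriv γ t‖ₑ := (measurable_deriv γ).enorm
  have hac : (volume.restrict I).withDensity (fun t => ‖deriv γ t‖ₑ) ≪ volume.restrict I :=
    withDensity_absolutelyContinuous _ _
  have hmap : (μH[1] : Measure E).restrict (γ '' I) =
      Measure.map γ ((volume.restrict I).withDensity fun t => ‖deriv γ t‖ₑ) := by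
    ext B hB
    rw [Measure.map_apply_of_aemeasurable (hγm.mono_ac hac) hB, Measure.restrict_apply hB]
    have h1 : B ∩ γ '' I = γ '' (γ ⁻¹' B ∩ I) := by
      ext p; constructor
      · rintro ⟨hp, t, ht, rfl⟩; exact ⟨t, ⟨hp, ht⟩, rfl⟩
      · rintro ⟨t, ⟨hp, ht⟩, rfl⟩; exact ⟨hp, t, ht, rfl⟩
    have hm : MeasurableSet (γ ⁻¹' B ∩ I) := by
      have h2 := (continuousOn_iff_continuous_domRestrict.1 hγ.continuousOn).measurable hB
      have h3 := (MeasurableSet.subtype_image hI.measurableSet) h2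
      convert h3 using 1
      ext t; simp [and_comm]
    rw [h1, hausdorffMeasure_image_eq_lintegral_speed hI hγ h0 hinj hm Set.inter_subset_right,
      withDensity_apply', Measure.restrict_restrict' hI.measurableSet]
  rw [hmap, lintegral_map' hf.aemeasurable (hγm.mono_ac hac)]
  refine (lintegral_withDensity_eq_lintegral_mul₀ hdm.aemeasurable
    (hf.comp_aemeasurable hγm)).trans ?_
  refine lintegral_congr fun t => ?_
  simp [mul_comm]

/-! ### Linear algebra in the parameter plane -/

namespace ClosedParametricSurface

noncomputable section

@[simp] lemma stdVec_apply (i j : Fin 2) : stdVec i j = if j = i then 1 else 0 := by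
  simp [stdVec]

lemma eq_smul_stdVec_add (v : ParamPlane) : v = v 0 • stdVec 0 + v 1 • stdVec 1 := by
  ext i; fin_cases i <;> simp

lemma map_eq_smul_add {E : Type*} [NormedAddCommGroup E] [NormedSpace ℝ E]
    (B : ParamPlane →L[ℝ] E) (v : ParamPlane) :
    B v = v 0 • B (stdVec 0) + v 1 • B (stdVec 1) := by
  conv_lhs => rw [eq_smul_stdVec_add v]
  simp

lemma map_apply_eq (A : ParamPlane →L[ℝ] ParamPlane) (v : ParamPlane) (i : Fin 2) :
    A v i = v 0 * A (stdVec 0) i + v 1 * A (stdVec 1) i := by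
  rw [map_eq_smul_add A v]; simp

lemma det_eq (A : ParamPlane →L[ℝ] ParamPlane) :
    A.det = A (stdVec 0) 0 * A (stdVec 1) 1 - A (stdVec 1) 0 * A (stdVec 0) 1 := by
  have h := LinearMap.det_toMatrix (EuclideanSpace.basisFun (Fin 2) ℝ).toBasis
    (A : ParamPlane →ₗ[ℝ] ParamPlane)
  rw [ContinuousLinearMap.det, ← h, Matrix.det_fin_two]
  simp [LinearMap.toMatrix_apply, stdVec]

lemma det_ne_zero_of_injective {A : ParamPlane →L[ℝ] ParamPlane} (hA : Function.Injective A) :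
    A.det ≠ 0 := by
  have := LinearEquiv.isUnit_det' (LinearEquiv.ofInjectiveEndo (A : ParamPlane →ₗ[ℝ] ParamPlane) hA)
  exact this.ne_zero

/-- The cofactor matrix of `A`, transposed, applied to `v`; it equals `det A • A⁻¹ v` when `A` is
invertible. -/
def cof (A : ParamPlane →L[ℝ] ParamPlane) (v : ParamPlane) : ParamPlane :=
  !₂[A (stdVec 1) 1 * v 0 - A (stdVec 1) 0 * v 1, A (stdVec 0) 0 * v 1 - A (stdVec 0) 1 * v 0]

lemma cof_apply_self (A : ParamPlane →L[ℝ] ParamPlane) (v : ParamPlane) :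
    cof A (A v) = A.det • v := by
  ext i
  fin_cases i <;>
  · simp only [cof, det_eq, map_apply_eq A v]
    simp
    ring

/-- The area of the parallelogram spanned by the images of the standard basis vectors. -/
def areaFactor {E : Type*} [NormedAddCommGroup E] [InnerProductSpace ℝ E]
    (B : ParamPlane →L[ℝ] E) : ℝ :=
  Real.sqrt (‖B (stdVec 0)‖ ^ 2 * ‖B (stdVec 1)‖ ^ 2 - inner ℝ (B (stdVec 0)) (B (stdVec 1)) ^ 2)

lemma sqrtDet_eq (X : ClosedParametricSurface) (x : ParamPlane) :
    X.sqrtDet x = areaFactor (X.J x) := by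
  rw [sqrtDet, areaFactor, Matrix.det_fin_two]
  simp only [g, Matrix.of_apply, real_inner_self_eq_norm_sq]
  rw [real_inner_comm (X.J x (stdVec 1))]
  ring_nf

section Gram

variable {E : Type*} [NormedAddCommGroup E] [InnerProductSpace ℝ E]

lemma norm_map_sq (B : ParamPlane →L[ℝ] E) (v : ParamPlane) :
    ‖B v‖ ^ 2 = v 0 ^ 2 * ‖B (stdVec 0)‖ ^ 2
      + 2 * (v 0 * v 1) * inner ℝ (B (stdVec 0)) (B (stdVec 1)) + v 1 ^ 2 * ‖B (stdVec 1)‖ ^ 2 := by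
  rw [map_eq_smul_add B v, norm_add_sq_real, norm_smul, norm_smul, inner_smul_left,
    inner_smul_right, mul_pow, mul_pow]
  simp only [Real.norm_eq_abs, sq_abs, conj_trivial]
  ring

lemma inner_map_map (B : ParamPlane →L[ℝ] E) (v w : ParamPlane) :
    inner ℝ (B v) (B w) = v 0 * w 0 * ‖B (stdVec 0)‖ ^ 2
      + (v 0 * w 1 + v 1 * w 0) * inner ℝ (B (stdVec 0)) (B (stdVec 1))
      + v 1 * w 1 * ‖B (stdVec 1)‖ ^ 2 := by
  rw [map_eq_smul_add B v, map_eq_smul_add B w]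
  simp only [inner_add_left, inner_add_right, inner_smul_left, inner_smul_right, conj_trivial,
    real_inner_self_eq_norm_sq]
  rw [real_inner_comm (B (stdVec 0)) (B (stdVec 1))]
  ring

lemma areaFactor_comp (B : ParamPlane →L[ℝ] E) (A : ParamPlane →L[ℝ] ParamPlane) :
    areaFactor (B.comp A) = |A.det| * areaFactor B := by
  rw [areaFactor, areaFactor, ← Real.sqrt_sq_eq_abs, ← Real.sqrt_mul (sq_nonneg _)]
  congr 1
  simp only [ContinuousLinearMap.comp_apply, norm_map_sq B (A _), inner_map_map B (A _), det_eq]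
  ring

lemma gram_pos {B : ParamPlane →L[ℝ] E} (hB : Function.Injective B) :
    0 < ‖B (stdVec 0)‖ ^ 2 * ‖B (stdVec 1)‖ ^ 2 - inner ℝ (B (stdVec 0)) (B (stdVec 1)) ^ 2 := by
  have h0 : B (stdVec 1) ≠ 0 := by
    rw [Ne, map_eq_zero_iff B hB]
    intro h
    have := congrArg (fun v : ParamPlane => v 1) h
    simp at this
  have h1 : 0 < ‖B (stdVec 1)‖ := norm_pos_iff.2 h0
  -- up to scaling, the vector whose image is orthogonal to that of the second basis vector
  set v : ParamPlane := !₂[‖B (stdVec 1)‖ ^ 2, - inner ℝ (B (stdVec 0)) (B (stdVec 1))] with hv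
  have hv0 : B v ≠ 0 := by
    rw [Ne, map_eq_zero_iff B hB]
    intro h
    have := congrArg (fun v : ParamPlane => v 0) h
    simp [hv] at this
    exact h0 this
  have h2 : 0 < ‖B v‖ ^ 2 := by have := norm_pos_iff.2 hv0; positivity
  have h3 : ‖B v‖ ^ 2 = ‖B (stdVec 1)‖ ^ 2 * (‖B (stdVec 0)‖ ^ 2 * ‖B (stdVec 1)‖ ^ 2
      - inner ℝ (B (stdVec 0)) (B (stdVec 1)) ^ 2) := by
    rw [norm_map_sq B v]
    simp [hv]
    ring
  rw [h3] at h2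
  exact pos_of_mul_pos_right h2 (by positivity)

lemma areaFactor_pos {B : ParamPlane →L[ℝ] E} (hB : Function.Injective B) : 0 < areaFactor B :=
  Real.sqrt_pos.2 (gram_pos hB)

lemma areaFactor_sq {B : ParamPlane →L[ℝ] E} (hB : Function.Injective B) :
    areaFactor B ^ 2 = ‖B (stdVec 0)‖ ^ 2 * ‖B (stdVec 1)‖ ^ 2
      - inner ℝ (B (stdVec 0)) (B (stdVec 1)) ^ 2 :=
  Real.sq_sqrt (gram_pos hB).le

lemma norm_stdVec_one_pos {B : ParamPlane →L[ℝ] E} (hB : Function.Injective B) :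
    0 < ‖B (stdVec 1)‖ := by
  rw [norm_pos_iff, Ne, map_eq_zero_iff B hB]
  intro h
  have := congrArg (fun v : ParamPlane => v 1) h
  simp at this

/-- The flux of `v` through the second coordinate line is at most its length times the norm of
`v`: the component of `v` tangent to that line does not contribute. -/
lemma areaFactor_mul_le {B : ParamPlane →L[ℝ] E} (hB : Function.Injective B) (v : ParamPlane) :
    areaFactor B * v 0 ≤ ‖B (stdVec 1)‖ * ‖B v‖ := by
  refine le_of_sq_le_sq ?_ (by positivity)
  rw [mul_pow, mul_pow, areaFactor_sq hB, norm_map_sq B v]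
  nlinarith [sq_nonneg (v 0 * inner ℝ (B (stdVec 0)) (B (stdVec 1)) + v 1 * ‖B (stdVec 1)‖ ^ 2)]

/-- The coordinates of the unit vector that is tangent to the surface, normal to the second
coordinate line, and points in the direction of growth of the first coordinate. -/
def conormal (B : ParamPlane →L[ℝ] E) : ParamPlane :=
  (‖B (stdVec 1)‖ * areaFactor B)⁻¹ •
    !₂[‖B (stdVec 1)‖ ^ 2, - inner ℝ (B (stdVec 0)) (B (stdVec 1))]

lemma norm_map_conormal {B : ParamPlane →L[ℝ] E} (hB : Function.Injective B) :
    ‖B (conormal B)‖ = 1 := by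
  have h1 := norm_stdVec_one_pos hB
  have h2 := areaFactor_pos hB
  have h3 := areaFactor_sq hB
  rw [← sq_eq_sq₀ (norm_nonneg _) zero_le_one, norm_map_sq]
  simp [conormal]
  field_simp
  rw [h3]
  ring

lemma areaFactor_mul_conormal {B : ParamPlane →L[ℝ] E} (hB : Function.Injective B) :
    areaFactor B * conormal B 0 = ‖B (stdVec 1)‖ := by
  have h1 := norm_stdVec_one_pos hB
  have h2 := areaFactor_pos hB
  simp [conormal]
  field_simp

lemma inner_map_conormal {B : ParamPlane →L[ℝ] E} (hB : Function.Injective B) (v : ParamPlane) :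
    inner ℝ (B (conormal B)) (B v) = areaFactor B / ‖B (stdVec 1)‖ * v 0 := by
  have h1 := norm_stdVec_one_pos hB
  have h2 := areaFactor_pos hB
  have h3 := areaFactor_sq hB
  rw [inner_map_map]
  simp [conormal]
  field_simp
  rw [h3]
  ring

end Gram

/-! ### Divergence in the parameter plane -/

/-- The Euclidean divergence of a vector field on the parameter plane. -/
def planeDiv (F : ParamPlane → ParamPlane) (x : ParamPlane) : ℝ :=
  ∑ i : Fin 2, fderiv ℝ (fun y => F y i) x (stdVec i)

lemma planeDiv_congr {F G : ParamPlane → ParamPlane} {x : ParamPlane}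
    (h : F =ᶠ[nhds x] G) : planeDiv F x = planeDiv G x := by
  unfold planeDiv
  refine Finset.sum_congr rfl fun i _ => ?_
  have : (fun y => F y i) =ᶠ[nhds x] fun y => G y i := h.mono fun y hy => by simp only [hy]
  rw [this.fderiv_eq]

/-- The Piola identity in the plane: pulling a vector field back by the cofactor matrix of the
derivative multiplies its divergence by the Jacobian determinant, because mixed second derivatives
commute. -/
lemma planeDiv_cof_comp {T F : ParamPlane → ParamPlane} {x : ParamPlane}
    (hT : ContDiffAt ℝ 2 T x) (hF : DifferentiableAt ℝ F (T x)) :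
    planeDiv (fun y => cof (fderiv ℝ T y) (F (T y))) x
      = (fderiv ℝ T x).det * planeDiv F (T x) := by
  have hT1 : DifferentiableAt ℝ T x := hT.differentiableAt (by norm_num)
  have hD : DifferentiableAt ℝ (fderiv ℝ T) x :=
    (hT.fderiv_right (m := 1) (by norm_num)).differentiableAt (by norm_num)
  have hsymm : ∀ v w, fderiv ℝ (fderiv ℝ T) x v w = fderiv ℝ (fderiv ℝ T) x w v := by
    have := hT.isSymmSndFDerivAt (by simp)
    exact fun v w => this v w
  -- derivatives of the entries of `DT` and of the components of `F ∘ T`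
  have hentry : ∀ i j : Fin 2, HasFDerivAt (fun y => fderiv ℝ T y (stdVec i) j)
      ((EuclideanSpace.proj j).comp ((fderiv ℝ (fderiv ℝ T) x).flip (stdVec i))) x := by
    intro i j
    have h1 : HasFDerivAt (fun y => fderiv ℝ T y (stdVec i))
        ((fderiv ℝ (fderiv ℝ T) x).flip (stdVec i)) x := by
      have := hD.hasFDerivAt.clm_apply (hasFDerivAt_const (stdVec i) x)
      simpa using this
    exact (EuclideanSpace.proj j : ParamPlane →L[ℝ] ℝ).hasFDerivAt.comp x h1
  have hcomp : ∀ j : Fin 2, HasFDerivAt (fun y => F (T y) j)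
      ((EuclideanSpace.proj j).comp ((fderiv ℝ F (T x)).comp (fderiv ℝ T x))) x := fun j =>
    (EuclideanSpace.proj j : ParamPlane →L[ℝ] ℝ).hasFDerivAt.comp x
      (hF.hasFDerivAt.comp x hT1.hasFDerivAt)
  have hFj : ∀ j : Fin 2, fderiv ℝ (fun y => F y j) (T x)
      = (EuclideanSpace.proj j).comp (fderiv ℝ F (T x)) := fun j =>
    ((EuclideanSpace.proj j : ParamPlane →L[ℝ] ℝ).hasFDerivAt.comp (T x) hF.hasFDerivAt).fderiv
  have h0 : HasFDerivAt (fun y => cof (fderiv ℝ T y) (F (T y)) 0) _ x :=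
    ((hentry 1 1).mul (hcomp 0)).sub ((hentry 1 0).mul (hcomp 1))
  have h1 : HasFDerivAt (fun y => cof (fderiv ℝ T y) (F (T y)) 1) _ x :=
    ((hentry 0 0).mul (hcomp 1)).sub ((hentry 0 1).mul (hcomp 0))
  rw [planeDiv, planeDiv, Fin.sum_univ_two, Fin.sum_univ_two, h0.fderiv, h1.fderiv, hFj, hFj,
    det_eq]
  simp only [_root_.add_apply, _root_.sub_apply,
    _root_.smul_apply, ContinuousLinearMap.comp_apply, smul_eq_mul,
    PiLp.proj_apply, ContinuousLinearMap.flip_apply, hsymm (stdVec 1) (stdVec 0),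
    map_apply_eq (fderiv ℝ F (T x)) (fderiv ℝ T x _)]
  ring

lemma measurePreserving_mkPlane :
    MeasurePreserving (fun p : ℝ × ℝ => (!₂[p.1, p.2] : ParamPlane)) := by
  exact (PiLp.volume_preserving_toLp (Fin 2)).comp (volume_preserving_finTwoArrow ℝ).symm

lemma measurableEmbedding_mkPlane :
    MeasurableEmbedding (fun p : ℝ × ℝ => (!₂[p.1, p.2] : ParamPlane)) := by
  exact ((MeasurableEquiv.finTwoArrow (α := ℝ)).symm.trans
    (MeasurableEquiv.toLp 2 (Fin 2 → ℝ))).measurableEmbedding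

lemma setIntegral_leftHalfPlane (f : ParamPlane → ℝ) :
    ∫ w in {w : ParamPlane | w 0 < 0}, f w
      = ∫ p : ℝ × ℝ, f !₂[p.1, p.2] ∂(volume.restrict (Set.Iio 0)).prod volume := by
  have h := measurePreserving_mkPlane.setIntegral_preimage_emb measurableEmbedding_mkPlane f
    {w : ParamPlane | w 0 < 0}
  rw [← h]
  have h2 : (fun p : ℝ × ℝ => (!₂[p.1, p.2] : ParamPlane)) ⁻¹' {w : ParamPlane | w 0 < 0}
      = Set.Iio 0 ×ˢ Set.univ := by
    ext p; simp
  rw [h2, Measure.volume_eq_prod, ← Measure.prod_restrict, Measure.restrict_univ]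

lemma hasDerivAt_horizontal (a b : ℝ) :
    HasDerivAt (fun s => (!₂[s, b] : ParamPlane)) (stdVec 0) a := by
  have h : (fun s => (!₂[s, b] : ParamPlane)) = fun s => s • stdVec 0 + b • stdVec 1 := by
    ext s i; fin_cases i <;> simp
  rw [h]
  simpa using ((hasDerivAt_id a).smul_const (stdVec 0)).add_const (b • stdVec 1)

lemma hasDerivAt_vertical (a b : ℝ) :
    HasDerivAt (fun s => (!₂[a, s] : ParamPlane)) (stdVec 1) b := by
  have h : (fun s => (!₂[a, s] : ParamPlane)) = fun s => a • stdVec 0 + s • stdVec 1 := by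
    ext s i; fin_cases i <;> simp
  rw [h]
  simpa using ((hasDerivAt_id b).smul_const (stdVec 1)).const_add (a • stdVec 0)

lemma isClosedEmbedding_horizontal (b : ℝ) :
    Topology.IsClosedEmbedding fun s : ℝ => (!₂[s, b] : ParamPlane) := by
  refine Isometry.isClosedEmbedding (Isometry.of_dist_eq fun s t => ?_)
  simp [EuclideanSpace.dist_eq]

lemma isClosedEmbedding_vertical (a : ℝ) :
    Topology.IsClosedEmbedding fun s : ℝ => (!₂[a, s] : ParamPlane) := by
  refine Isometry.isClosedEmbedding (Isometry.of_dist_eq fun s t => ?_)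
  simp [EuclideanSpace.dist_eq]

lemma integrable_planeDiv {F : ParamPlane → ParamPlane} (hF : ContDiff ℝ 1 F)
    (hc : HasCompactSupport F) : Integrable (planeDiv F) := by
  refine integrable_finsetSum _ fun i _ => ?_
  have hFi : ContDiff ℝ 1 fun w => F w i :=
    (EuclideanSpace.proj i : ParamPlane →L[ℝ] ℝ).contDiff.comp hF
  have hci : HasCompactSupport fun w => F w i := hc.comp_left (g := fun v : ParamPlane => v i) rfl
  exact ((hFi.continuous_fderiv (by norm_num)).clm_apply
    continuous_const).integrable_of_hasCompactSupport (hci.fderiv_apply ℝ (stdVec i))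

lemma ae_apply_zero_ne_zero : ∀ᵐ w : ParamPlane, w 0 ≠ 0 := by
  have h : volume ((LinearMap.ker (EuclideanSpace.proj 0 : ParamPlane →L[ℝ] ℝ).toLinearMap :
      Submodule ℝ ParamPlane) : Set ParamPlane) = 0 := by
    refine Measure.addHaar_submodule _ _ fun htop => ?_
    have : stdVec 0 ∈ LinearMap.ker (EuclideanSpace.proj 0 : ParamPlane →L[ℝ] ℝ).toLinearMap := by
      rw [htop]; trivial
    simp at this
  refine measure_mono_null (fun w hw => ?_) h
  simpa using hw

/-- The divergence theorem on a half-plane for compactly supported fields. -/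
lemma setIntegral_planeDiv {F : ParamPlane → ParamPlane} (hF : ContDiff ℝ 1 F)
    (hc : HasCompactSupport F) :
    ∫ w in {w : ParamPlane | w 0 < 0}, planeDiv F w = ∫ t : ℝ, F !₂[0, t] 0 := by
  have hFi : ∀ i : Fin 2, ContDiff ℝ 1 fun w => F w i := fun i =>
    (EuclideanSpace.proj i : ParamPlane →L[ℝ] ℝ).contDiff.comp hF
  have hci : ∀ i : Fin 2, HasCompactSupport fun w => F w i := fun i =>
    hc.comp_left (g := fun v : ParamPlane => v i) rfl
  have hdc : ∀ i : Fin 2, Continuous fun w => fderiv ℝ (fun y => F y i) w (stdVec i) := fun i =>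
    ((hFi i).continuous_fderiv (by norm_num)).clm_apply continuous_const
  have hdi : ∀ i : Fin 2, Integrable fun w => fderiv ℝ (fun y => F y i) w (stdVec i) := fun i =>
    (hdc i).integrable_of_hasCompactSupport ((hci i).fderiv_apply ℝ (stdVec i))
  have hprod : ∀ i : Fin 2, Integrable
      (fun p : ℝ × ℝ => fderiv ℝ (fun y => F y i) !₂[p.1, p.2] (stdVec i))
      ((volume.restrict (Set.Iio 0)).prod volume) := by
    intro i
    have h1 := measurePreserving_mkPlane.integrable_comp_of_integrable (hdi i)
    have h2 := h1.integrableOn (s := Set.Iio 0 ×ˢ Set.univ)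
    rwa [IntegrableOn, Measure.volume_eq_prod, ← Measure.prod_restrict, Measure.restrict_univ]
      at h2
  have hcurve : ∀ (i : Fin 2) (q : ℝ → ParamPlane) (t : ℝ), HasDerivAt q (stdVec i) t →
      HasDerivAt (fun s => F (q s) i) (fderiv ℝ (fun y => F y i) (q t) (stdVec i)) t := by
    intro i q t hq
    exact (((hFi i).differentiable (by norm_num)) (q t)).hasFDerivAt.comp_hasDerivAt t hq
  unfold planeDiv
  simp only [Fin.sum_univ_two]
  rw [integral_add (hdi 0).integrableOn (hdi 1).integrableOn, setIntegral_leftHalfPlane,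
    setIntegral_leftHalfPlane, integral_prod_symm _ (hprod 0), integral_prod _ (hprod 1)]
  have h1 : ∀ a : ℝ, ∫ b : ℝ, fderiv ℝ (fun y => F y 1) !₂[a, b] (stdVec 1) = 0 := by
    intro a
    have hcs : HasCompactSupport fun s : ℝ => F !₂[a, s] 1 :=
      (hci 1).comp_isClosedEmbedding (isClosedEmbedding_vertical a)
    have hcd : HasCompactSupport fun s : ℝ => fderiv ℝ (fun y => F y 1) !₂[a, s] (stdVec 1) :=
      ((hci 1).fderiv_apply ℝ (stdVec 1)).comp_isClosedEmbedding (isClosedEmbedding_vertical a)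
    exact integral_eq_zero_of_hasDerivAt_of_integrable
      (fun b => hcurve 1 _ b (hasDerivAt_vertical a b))
      (((hdc 1).comp (isClosedEmbedding_vertical a).continuous).integrable_of_hasCompactSupport hcd)
      (((hFi 1).continuous.comp
        (isClosedEmbedding_vertical a).continuous).integrable_of_hasCompactSupport hcs)
  have h0 : ∀ b : ℝ, ∫ a in Set.Iio 0, fderiv ℝ (fun y => F y 0) !₂[a, b] (stdVec 0)
      = F !₂[0, b] 0 := by
    intro b
    rw [← integral_Iic_eq_integral_Iio]
    have hcs : HasCompactSupport fun s : ℝ => F !₂[s, b] 0 :=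
      (hci 0).comp_isClosedEmbedding (isClosedEmbedding_horizontal b)
    have hcd : HasCompactSupport fun s : ℝ => fderiv ℝ (fun y => F y 0) !₂[s, b] (stdVec 0) :=
      ((hci 0).fderiv_apply ℝ (stdVec 0)).comp_isClosedEmbedding (isClosedEmbedding_horizontal b)
    rw [integral_Iic_of_hasDerivAt_of_tendsto' (m := 0)
      (fun a _ => hcurve 0 _ a (hasDerivAt_horizontal a b))
      (((hdc 0).comp
        (isClosedEmbedding_horizontal b).continuous).integrable_of_hasCompactSupport
          hcd).integrableOn,
      sub_zero]
    rw [hasCompactSupport_iff_eventuallyEq, Filter.coclosedCompact_eq_cocompact] at hcs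
    exact (hcs.filter_mono atBot_le_cocompact).tendsto
  simp only [h0, h1, integral_zero, add_zero]

end

end ClosedParametricSurface

/-! ### Charts adapted to a set with smooth boundary -/

namespace ClosedParametricSurface

noncomputable section

/-- A local coordinate system `Θ` of the surface, defined on an open set `O` of the ambient space,
with values in the open set `W` of the plane, in which `D` is the half-plane where the
first coordinate is negative, up to the line where it vanishes. `κ` expresses the inverse of the
coordinate system through the given parametrization: the point with coordinates `w` is `S (κ w)`.
Charts that do not meet the boundary of `D` are included: there the first coordinate has constant
sign. Class `C²` is what the transformation of divergences of `C¹` fields needs, and unlike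
smoothness it spreads from a point to a neighbourhood in the inverse function theorem. -/
structure AdaptedChart (X : ClosedParametricSurface) (D : Set AmbientSpace) where
  /-- the open set of the ambient space on which the coordinates are defined -/
  O : Set AmbientSpace
  /-- the coordinates -/
  Θ : AmbientSpace → ParamPlane
  /-- the range of the coordinates -/
  W : Set ParamPlane
  /-- a parameter of the point with given coordinates -/
  κ : ParamPlane → ParamPlane
  isOpen_O : IsOpen O
  isOpen_W : IsOpen W
  contDiffOn_Θ : ContDiffOn ℝ 2 Θ O
  contDiffOn_κ : ContDiffOn ℝ 2 κ W
  mapsTo_κ : Set.MapsTo κ W X.U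
  Θ_mem : ∀ x ∈ X.U, X.S x ∈ O → Θ (X.S x) ∈ W
  S_κ_Θ : ∀ x ∈ X.U, X.S x ∈ O → X.S (κ (Θ (X.S x))) = X.S x
  S_κ_mem : ∀ w ∈ W, X.S (κ w) ∈ O
  Θ_S_κ : ∀ w ∈ W, Θ (X.S (κ w)) = w
  mem_of_neg : ∀ x ∈ X.U, X.S x ∈ O → Θ (X.S x) 0 < 0 → X.S x ∈ D
  notMem_of_pos : ∀ x ∈ X.U, X.S x ∈ O → 0 < Θ (X.S x) 0 → X.S x ∉ D

/-- The inverse function theorem in the plane, for maps of class `C²`. -/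
lemma exists_local_inverse {F : ParamPlane → ParamPlane} {x₀ : ParamPlane}
    (hF : ContDiffAt ℝ 2 F x₀) (hinj : Function.Injective (fderiv ℝ F x₀)) :
    ∃ N : Set ParamPlane, IsOpen N ∧ x₀ ∈ N ∧ ∃ G : ParamPlane → ParamPlane,
      (∀ x ∈ N, G (F x) = x) ∧
      ∀ N' ⊆ N, IsOpen N' → IsOpen (F '' N') ∧ ContDiffOn ℝ 2 G (F '' N') := by
  let A : ParamPlane ≃L[ℝ] ParamPlane :=
    (LinearEquiv.ofInjectiveEndo (fderiv ℝ F x₀ : ParamPlane →ₗ[ℝ] ParamPlane)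
      hinj).toContinuousLinearEquiv
  have hA : HasFDerivAt F (A : ParamPlane →L[ℝ] ParamPlane) x₀ :=
    (hF.differentiableAt (by norm_num)).hasFDerivAt
  let e := hF.toOpenPartialHomeomorph F hA (by norm_num)
  have he : (e : ParamPlane → ParamPlane) = F := hF.toOpenPartialHomeomorph_coe hA (by norm_num)
  have hx₀ : x₀ ∈ e.source := hF.mem_toOpenPartialHomeomorph_source hA (by norm_num)
  have hG : ContDiffAt ℝ 2 e.symm (F x₀) := hF.to_localInverse hA (by norm_num)
  obtain ⟨Q, hQ, hQo, hQx⟩ := eventually_nhds_iff.1 (hG.eventually (by norm_num))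
  refine ⟨e.source ∩ e ⁻¹' Q, e.isOpen_inter_preimage hQo, ⟨hx₀, ?_⟩, e.symm, ?_, ?_⟩
  · rw [Set.mem_preimage, he]; exact hQx
  · rintro x ⟨hx, -⟩
    rw [← he]; exact e.left_inv hx
  · intro N' hN' hN'o
    rw [← he]
    refine ⟨e.isOpen_image_of_subset_source hN'o (hN'.trans Set.inter_subset_left), ?_⟩
    rintro _ ⟨x, hx, rfl⟩
    exact (hQ _ (hN' hx).2).contDiffWithinAt

/-- A function with nonvanishing differential at a point is the first component of a local
diffeomorphism there. -/
lemma exists_injective_fderiv_pair {h : ParamPlane → ℝ} {x₀ : ParamPlane}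
    (hh : ContDiffAt ℝ 2 h x₀) (h0 : fderiv ℝ h x₀ ≠ 0) :
    ∃ Φ : ParamPlane → ParamPlane, (∀ y, Φ y 0 = h y) ∧ ContDiffAt ℝ 2 Φ x₀ ∧
      Function.Injective (fderiv ℝ Φ x₀) := by
  set a := fderiv ℝ h x₀ (stdVec 0) with ha
  set b := fderiv ℝ h x₀ (stdVec 1) with hb
  set l : ParamPlane →L[ℝ] ℝ := a • EuclideanSpace.proj 1 - b • EuclideanSpace.proj 0 with hl
  have hab : 0 < a ^ 2 + b ^ 2 := by
    by_contra hcon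
    have ha0 : a = 0 := by nlinarith [sq_nonneg a, sq_nonneg b]
    have hb0 : b = 0 := by nlinarith [sq_nonneg a, sq_nonneg b]
    refine h0 (ContinuousLinearMap.ext fun v => ?_)
    rw [map_eq_smul_add (fderiv ℝ h x₀) v, ← ha, ← hb, ha0, hb0]
    simp
  have hder : HasFDerivAt (fun y => h y • stdVec 0 + l y • stdVec 1)
      ((fderiv ℝ h x₀).smulRight (stdVec 0) + l.smulRight (stdVec 1)) x₀ :=
    ((hh.differentiableAt (by norm_num)).hasFDerivAt.smul_const (stdVec 0)).add
      (l.hasFDerivAt.smul_const (stdVec 1))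
  refine ⟨fun y => h y • stdVec 0 + l y • stdVec 1, fun y => by simp, ?_, ?_⟩
  · exact (hh.smul contDiffAt_const).add (l.contDiff.contDiffAt.smul contDiffAt_const)
  · rw [hder.fderiv, injective_iff_map_eq_zero]
    intro v hv
    have e0 := congrArg (fun u : ParamPlane => u 0) hv
    have e1 := congrArg (fun u : ParamPlane => u 1) hv
    rw [_root_.add_apply, ContinuousLinearMap.smulRight_apply,
      map_eq_smul_add (fderiv ℝ h x₀) v, ← ha, ← hb] at e0 e1
    simp [hl] at e0 e1
    have hv0 : (a ^ 2 + b ^ 2) * v 0 = 0 := by linear_combination a * e0 - b * e1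
    have hv1 : (a ^ 2 + b ^ 2) * v 1 = 0 := by linear_combination b * e0 + a * e1
    ext i
    fin_cases i
    · exact (mul_eq_zero.1 hv0).resolve_left hab.ne'
    · exact (mul_eq_zero.1 hv1).resolve_left hab.ne'

variable {X : ClosedParametricSurface} {D : Set AmbientSpace}

lemma S_mem_M {x : ParamPlane} (hx : x ∈ X.U) : X.S x ∈ X.M := X.mapsTo hx

lemma exists_param {p : AmbientSpace} (hp : p ∈ X.M) : ∃ x ∈ X.U, X.S x = p := by
  obtain ⟨x, hx, rfl⟩ := hp
  exact ⟨x, X.Ω_subset_U hx, rfl⟩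

/-- Every point has a defining function of `D` around it; away from the boundary of `D` an affine
function of constant sign serves. -/
lemma HasSmoothBoundary.exists_defining_function (hD : X.HasSmoothBoundary D) {x : ParamPlane}
    (hx : x ∈ X.U) : ∃ (V : Set ParamPlane) (h : ParamPlane → ℝ), IsOpen V ∧ x ∈ V ∧ V ⊆ X.U ∧
      ContDiffOn ℝ ∞ h V ∧ fderiv ℝ h x ≠ 0 ∧
      ∀ y ∈ V, (h y < 0 → X.S y ∈ D) ∧ (0 < h y → X.S y ∉ D) := by
  have haff : ∀ c : ℝ, ContDiff ℝ ∞ (fun y : ParamPlane => y 0 - c) ∧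
      fderiv ℝ (fun y : ParamPlane => y 0 - c) x ≠ 0 := by
    intro c
    have h1 : HasFDerivAt (fun y : ParamPlane => y 0 - c)
        (EuclideanSpace.proj 0 : ParamPlane →L[ℝ] ℝ) x :=
      (EuclideanSpace.proj 0 : ParamPlane →L[ℝ] ℝ).hasFDerivAt.sub_const c
    refine ⟨(EuclideanSpace.proj 0 : ParamPlane →L[ℝ] ℝ).contDiff.sub contDiff_const, ?_⟩
    rw [h1.fderiv]
    intro h2
    have := congrArg (fun f : ParamPlane →L[ℝ] ℝ => f (stdVec 0)) h2
    simp at this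
  have hopen : ∀ P : Set AmbientSpace, IsOpen P → IsOpen (X.U ∩ X.S ⁻¹' P) := fun P hP =>
    X.smooth.continuousOn.isOpen_inter_preimage X.isOpen_U hP
  by_cases hb : X.S x ∈ X.boundary D
  · obtain ⟨V, h, hV, hxV, hVU, hh, -, h0, hs⟩ := hD.exists_defining x hx hb
    exact ⟨V, h, hV, hxV, hVU, hh, h0, hs⟩
  · rw [boundary, Set.mem_inter_iff, not_and_or] at hb
    rcases hb with hb | hb
    · refine ⟨(X.U ∩ X.S ⁻¹' (closure D)ᶜ) ∩ {y | 0 < y 0 - (x 0 - 1)},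
        fun y => y 0 - (x 0 - 1), (hopen _ isClosed_closure.isOpen_compl).inter
          (isOpen_lt continuous_const (haff _).1.continuous), ⟨⟨hx, hb⟩, ?_⟩,
          fun y hy => hy.1.1, (haff _).1.contDiffOn, (haff _).2, ?_⟩
      · show 0 < x 0 - (x 0 - 1)
        simp
      · rintro y ⟨⟨-, hy⟩, hy0⟩
        exact ⟨fun hlt => absurd hlt (not_lt.2 (le_of_lt hy0)),
          fun _ hyD => hy (subset_closure hyD)⟩
    · refine ⟨(X.U ∩ X.S ⁻¹' (closure (X.M \ D))ᶜ) ∩ {y | y 0 - (x 0 + 1) < 0},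
        fun y => y 0 - (x 0 + 1), (hopen _ isClosed_closure.isOpen_compl).inter
          (isOpen_lt (haff _).1.continuous continuous_const), ⟨⟨hx, hb⟩, ?_⟩,
          fun y hy => hy.1.1, (haff _).1.contDiffOn, (haff _).2, ?_⟩
      · show x 0 - (x 0 + 1) < 0
        simp
      · rintro y ⟨⟨hyU, hy⟩, hy0⟩
        refine ⟨fun _ => ?_, fun hlt => absurd hlt (not_lt.2 (le_of_lt hy0))⟩
        by_contra hyD
        exact hy (subset_closure ⟨S_mem_M hyU, hyD⟩)

/-- Adapted charts exist around every point. With `h` a defining function completed to a local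
diffeomorphism `Φ` and `L` a linear projection such that `L ∘ S` is a local diffeomorphism, the
coordinates are `Φ ∘ (L ∘ S)⁻¹ ∘ L`. -/
lemma HasSmoothBoundary.exists_adaptedChart (hD : X.HasSmoothBoundary D) {x₀ : ParamPlane}
    (hx₀ : x₀ ∈ X.U) : ∃ c : AdaptedChart X D, X.S x₀ ∈ c.O := by
  obtain ⟨V, h, hV, hxV, hVU, hh, h0, hs⟩ := hD.exists_defining_function hx₀
  have hh2 : ContDiffAt ℝ 2 h x₀ := (hh.contDiffAt (hV.mem_nhds hxV)).of_le (by norm_cast)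
  obtain ⟨Φ, hΦh, hΦ, hΦinj⟩ := exists_injective_fderiv_pair hh2 h0
  have hS : ContDiffAt ℝ 2 X.S x₀ :=
    (X.smooth.contDiffAt (X.isOpen_U.mem_nhds hx₀)).of_le (by norm_cast)
  obtain ⟨L', hL'⟩ := LinearMap.exists_leftInverse_of_injective
    (fderiv ℝ X.S x₀ : ParamPlane →ₗ[ℝ] AmbientSpace) (LinearMap.ker_eq_bot.2 (X.immersion x₀ hx₀))
  set L : AmbientSpace →L[ℝ] ParamPlane := LinearMap.toContinuousLinearMap L' with hL
  have hF : ContDiffAt ℝ 2 (fun y => L (X.S y)) x₀ := L.contDiff.contDiffAt.comp x₀ hS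
  have hFinj : Function.Injective (fderiv ℝ (fun y => L (X.S y)) x₀) := by
    have h1 : HasFDerivAt (fun y => L (X.S y)) (L.comp (fderiv ℝ X.S x₀)) x₀ :=
      L.hasFDerivAt.comp x₀ (hS.differentiableAt (by norm_num)).hasFDerivAt
    rw [h1.fderiv]
    intro v w hvw
    have h2 : ∀ v, L (fderiv ℝ X.S x₀ v) = v := fun v => congrArg (fun f => f v) hL'
    simpa [h2] using hvw
  obtain ⟨N₁, hN₁, hxN₁, G, hG, hN₁'⟩ := exists_local_inverse hF hFinj
  obtain ⟨N₂, hN₂, hxN₂, κ, hκ, hN₂'⟩ := exists_local_inverse hΦ hΦinj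
  obtain ⟨N₃, hN₃', hN₃, hxN₃⟩ := eventually_nhds_iff.1 (hΦ.eventually (by norm_num))
  set N := N₁ ∩ N₂ ∩ N₃ ∩ V with hN
  have hNo : IsOpen N := ((hN₁.inter hN₂).inter hN₃).inter hV
  have hxN : x₀ ∈ N := ⟨⟨⟨hxN₁, hxN₂⟩, hxN₃⟩, hxV⟩
  have hNU : N ⊆ X.U := fun y hy => hVU hy.2
  obtain ⟨hFN, hGc⟩ := hN₁' N (fun y hy => hy.1.1.1) hNo
  obtain ⟨hΦN, hκc⟩ := hN₂' N (fun y hy => hy.1.1.2) hNo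
  obtain ⟨P, hP, hSP⟩ := X.isOpen_image N hNU hNo
  have hGF : ∀ y ∈ N, G (L (X.S y)) = y := fun y hy => hG y hy.1.1.1
  have hκΦ : ∀ y ∈ N, κ (Φ y) = y := fun y hy => hκ y hy.1.1.2
  have hlift : ∀ p ∈ X.M, p ∈ P → ∃ y ∈ N, X.S y = p := fun p hpM hpP => by
    have : p ∈ X.S '' N := by rw [hSP]; exact ⟨hpM, hpP⟩
    exact this
  have hNP : ∀ y ∈ N, X.S y ∈ P := fun y hy => by
    have : X.S y ∈ X.S '' N := ⟨y, hy, rfl⟩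
    rw [hSP] at this
    exact this.2
  refine ⟨{
    O := P ∩ L ⁻¹' ((fun y => L (X.S y)) '' N)
    Θ := fun p => Φ (G (L p))
    W := Φ '' N
    κ := κ
    isOpen_O := hP.inter (hFN.preimage L.continuous)
    isOpen_W := hΦN
    contDiffOn_Θ := ?_
    contDiffOn_κ := hκc
    mapsTo_κ := ?_
    Θ_mem := ?_
    S_κ_Θ := ?_
    S_κ_mem := ?_
    Θ_S_κ := ?_
    mem_of_neg := ?_
    notMem_of_pos := ?_ }, hNP x₀ hxN, x₀, hxN, rfl⟩
  · rintro p ⟨-, y, hy, hyp⟩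
    refine ContDiffAt.contDiffWithinAt ?_
    have h1 : ContDiffAt ℝ 2 (fun p => G (L p)) p := by
      refine ContDiffAt.comp p ?_ L.contDiff.contDiffAt
      exact hGc.contDiffAt (hFN.mem_nhds ⟨y, hy, hyp⟩)
    refine ContDiffAt.comp p ?_ h1
    simp only [← hyp, hGF y hy]
    exact hN₃' y hy.1.2
  · rintro _ ⟨y, hy, rfl⟩
    rw [hκΦ y hy]; exact hNU hy
  · rintro x hx ⟨hxP, -⟩
    obtain ⟨y, hy, hyx⟩ := hlift _ (S_mem_M hx) hxP
    rw [← hyx, hGF y hy]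
    exact ⟨y, hy, rfl⟩
  · rintro x hx ⟨hxP, -⟩
    obtain ⟨y, hy, hyx⟩ := hlift _ (S_mem_M hx) hxP
    rw [← hyx, hGF y hy, hκΦ y hy]
  · rintro _ ⟨y, hy, rfl⟩
    rw [hκΦ y hy]
    exact ⟨hNP y hy, y, hy, rfl⟩
  · rintro _ ⟨y, hy, rfl⟩
    rw [hκΦ y hy, hGF y hy]
  · rintro x hx ⟨hxP, -⟩
    obtain ⟨y, hy, hyx⟩ := hlift _ (S_mem_M hx) hxP
    rw [← hyx, hGF y hy, hΦh]
    exact (hs y hy.2).1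
  · rintro x hx ⟨hxP, -⟩
    obtain ⟨y, hy, hyx⟩ := hlift _ (S_mem_M hx) hxP
    rw [← hyx, hGF y hy, hΦh]
    exact (hs y hy.2).2

end

end ClosedParametricSurface

/-! ### Calculus in adapted charts -/

namespace ClosedParametricSurface

noncomputable section

lemma contDiffAt_areaFactor {E : Type*} [NormedAddCommGroup E] [InnerProductSpace ℝ E]
    {B : ParamPlane →L[ℝ] E} (hB : Function.Injective B) {n : ℕ∞} :
    ContDiffAt ℝ n (areaFactor (E := E)) B := by
  have hv : ∀ v : ParamPlane, ContDiff ℝ n fun B : ParamPlane →L[ℝ] E => B v := fun v =>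
    contDiff_id.clm_apply contDiff_const
  have h : ContDiff ℝ n fun B : ParamPlane →L[ℝ] E => ‖B (stdVec 0)‖ ^ 2 * ‖B (stdVec 1)‖ ^ 2
      - inner ℝ (B (stdVec 0)) (B (stdVec 1)) ^ 2 :=
    (((hv _).norm_sq ℝ).mul ((hv _).norm_sq ℝ)).sub (((hv _).inner ℝ (hv _)).pow 2)
  exact h.contDiffAt.sqrt (gram_pos hB).ne'

variable {X : ClosedParametricSurface} {D : Set AmbientSpace}

lemma contDiffOn_J {n : ℕ∞} : ContDiffOn ℝ n X.J X.U := by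
  have h := X.smooth.fderiv_of_isOpen (m := (n : WithTop ℕ∞)) X.isOpen_U
    (by norm_cast; exact le_top)
  exact h

lemma contDiffOn_sqrtDet {n : ℕ∞} : ContDiffOn ℝ n X.sqrtDet X.U := by
  intro x hx
  have h1 : ContDiffAt ℝ n (fun y => areaFactor (X.J y)) x :=
    (contDiffAt_areaFactor (X.immersion x hx)).comp x
      (contDiffOn_J.contDiffAt (X.isOpen_U.mem_nhds hx))
  exact (h1.congr_of_eventuallyEq (Filter.Eventually.of_forall (sqrtDet_eq X))).contDiffWithinAt

lemma sqrtDet_pos {x : ParamPlane} (hx : x ∈ X.U) : 0 < X.sqrtDet x := by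
  rw [sqrtDet_eq]; exact areaFactor_pos (X.immersion x hx)

lemma div_eq (z : ParamPlane → ParamPlane) (x : ParamPlane) :
    X.div z x = (X.sqrtDet x)⁻¹ * planeDiv (fun y => X.sqrtDet y • z y) x := by
  simp [div, planeDiv]

namespace AdaptedChart

variable (c : AdaptedChart X D)

/-- The part of the parameter domain that is mapped into the chart. -/
def dom : Set ParamPlane := X.U ∩ X.S ⁻¹' c.O

/-- The coordinates of the chart, as a function of the given parameters. -/
def T (x : ParamPlane) : ParamPlane := c.Θ (X.S x)

/-- The local parametrization of the surface inverse to the chart. -/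
def σ (w : ParamPlane) : AmbientSpace := X.S (c.κ w)

lemma isOpen_dom : IsOpen c.dom :=
  X.smooth.continuousOn.isOpen_inter_preimage X.isOpen_U c.isOpen_O

lemma κ_mem_dom {w : ParamPlane} (hw : w ∈ c.W) : c.κ w ∈ c.dom :=
  ⟨c.mapsTo_κ hw, c.S_κ_mem w hw⟩

lemma T_mem {x : ParamPlane} (hx : x ∈ c.dom) : c.T x ∈ c.W := c.Θ_mem x hx.1 hx.2

lemma T_κ {w : ParamPlane} (hw : w ∈ c.W) : c.T (c.κ w) = w := c.Θ_S_κ w hw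

lemma σ_T {x : ParamPlane} (hx : x ∈ c.dom) : c.σ (c.T x) = X.S x := c.S_κ_Θ x hx.1 hx.2

lemma contDiffOn_S_two : ContDiffOn ℝ 2 X.S X.U := X.smooth.of_le (by norm_cast)

lemma contDiffOn_T : ContDiffOn ℝ 2 c.T c.dom :=
  c.contDiffOn_Θ.comp (contDiffOn_S_two.mono Set.inter_subset_left) fun _ hx => hx.2

lemma contDiffOn_σ : ContDiffOn ℝ 2 c.σ c.W :=
  contDiffOn_S_two.comp c.contDiffOn_κ c.mapsTo_κ

lemma contDiffAt_T {x : ParamPlane} (hx : x ∈ c.dom) : ContDiffAt ℝ 2 c.T x :=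
  c.contDiffOn_T.contDiffAt (c.isOpen_dom.mem_nhds hx)

lemma contDiffAt_σ {w : ParamPlane} (hw : w ∈ c.W) : ContDiffAt ℝ 2 c.σ w :=
  c.contDiffOn_σ.contDiffAt (c.isOpen_W.mem_nhds hw)

lemma J_eq_comp {x : ParamPlane} (hx : x ∈ c.dom) :
    X.J x = (fderiv ℝ c.σ (c.T x)).comp (fderiv ℝ c.T x) := by
  have h1 : HasFDerivAt (fun y => c.σ (c.T y))
      ((fderiv ℝ c.σ (c.T x)).comp (fderiv ℝ c.T x)) x :=
    ((c.contDiffAt_σ (c.T_mem hx)).differentiableAt (by norm_num)).hasFDerivAt.comp x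
      ((c.contDiffAt_T hx).differentiableAt (by norm_num)).hasFDerivAt
  have h2 : X.S =ᶠ[nhds x] fun y => c.σ (c.T y) :=
    Filter.eventuallyEq_of_mem (c.isOpen_dom.mem_nhds hx) fun y hy => (c.σ_T hy).symm
  rw [J, h2.fderiv_eq, h1.fderiv]

lemma fderiv_T_eq {x : ParamPlane} (hx : x ∈ c.dom) :
    fderiv ℝ c.T x = (fderiv ℝ c.Θ (X.S x)).comp (X.J x) := by
  have h1 : HasFDerivAt c.T ((fderiv ℝ c.Θ (X.S x)).comp (X.J x)) x :=
    ((c.contDiffOn_Θ.contDiffAt (c.isOpen_O.mem_nhds hx.2)).differentiableAt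
      (by norm_num)).hasFDerivAt.comp x
      ((contDiffOn_S_two.contDiffAt (X.isOpen_U.mem_nhds hx.1)).differentiableAt
        (by norm_num)).hasFDerivAt
  exact h1.fderiv

lemma injective_fderiv_T {x : ParamPlane} (hx : x ∈ c.dom) :
    Function.Injective (fderiv ℝ c.T x) := by
  have h := X.immersion x hx.1
  change Function.Injective (X.J x) at h
  rw [c.J_eq_comp hx] at h
  exact Function.Injective.of_comp h

lemma injective_fderiv_σ {w : ParamPlane} (hw : w ∈ c.W) :
    Function.Injective (fderiv ℝ c.σ w) := by
  have h1 : HasFDerivAt (fun y => c.Θ (c.σ y)) ((fderiv ℝ c.Θ (c.σ w)).comp (fderiv ℝ c.σ w)) w :=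
    ((c.contDiffOn_Θ.contDiffAt (c.isOpen_O.mem_nhds (c.S_κ_mem w hw))).differentiableAt
      (by norm_num)).hasFDerivAt.comp w
      ((c.contDiffAt_σ hw).differentiableAt (by norm_num)).hasFDerivAt
  have h2 : (fun y => c.Θ (c.σ y)) =ᶠ[nhds w] id :=
    Filter.eventuallyEq_of_mem (c.isOpen_W.mem_nhds hw) fun y hy => c.Θ_S_κ y hy
  have h3 := h1.fderiv
  rw [h2.fderiv_eq, fderiv_id] at h3
  intro u v huv
  have h4 : ∀ u, fderiv ℝ c.Θ (c.σ w) (fderiv ℝ c.σ w u) = u := fun u =>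
    (congrArg (fun f : ParamPlane →L[ℝ] ParamPlane => f u) h3).symm
  rw [← h4 u, ← h4 v, huv]

lemma sqrtDet_eq_mul {x : ParamPlane} (hx : x ∈ c.dom) :
    X.sqrtDet x = |(fderiv ℝ c.T x).det| * areaFactor (fderiv ℝ c.σ (c.T x)) := by
  rw [sqrtDet_eq, c.J_eq_comp hx, areaFactor_comp]

/-- The components of a field in the chart. -/
def push (z : ParamPlane → ParamPlane) (w : ParamPlane) : ParamPlane :=
  fderiv ℝ c.T (c.κ w) (z (c.κ w))

/-- The components of a field in the chart, multiplied by the area density of the chart. The flux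
of the field through the second coordinate lines is given by the first component. -/
def flux (z : ParamPlane → ParamPlane) (w : ParamPlane) : ParamPlane :=
  areaFactor (fderiv ℝ c.σ w) • c.push z w

lemma fderiv_T_apply {z : ParamPlane → ParamPlane} (hz : X.IsField z) {x : ParamPlane}
    (hx : x ∈ c.dom) : fderiv ℝ c.T x (z x) = c.push z (c.T x) := by
  have hκ := c.κ_mem_dom (c.T_mem hx)
  have hS : X.S (c.κ (c.T x)) = X.S x := c.σ_T hx
  rw [push, c.fderiv_T_eq hx, c.fderiv_T_eq hκ, hS, ContinuousLinearMap.comp_apply,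
    ContinuousLinearMap.comp_apply, hz.compatible x hx.1 _ hκ.1 hS.symm]

lemma fderiv_σ_push (z : ParamPlane → ParamPlane) {w : ParamPlane} (hw : w ∈ c.W) :
    fderiv ℝ c.σ w (c.push z w) = X.J (c.κ w) (z (c.κ w)) := by
  rw [c.J_eq_comp (c.κ_mem_dom hw), c.T_κ hw, ContinuousLinearMap.comp_apply, push]

lemma contDiffOn_flux {z : ParamPlane → ParamPlane} (hz : X.IsField z) :
    ContDiffOn ℝ 1 (c.flux z) c.W := by
  have hκ : ContDiffOn ℝ 1 c.κ c.W := c.contDiffOn_κ.of_le (by norm_num)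
  have h1 : ContDiffOn ℝ 1 (fderiv ℝ c.T) c.dom :=
    c.contDiffOn_T.fderiv_of_isOpen c.isOpen_dom (by norm_num)
  have h2 : ContDiffOn ℝ 1 (fderiv ℝ c.σ) c.W :=
    c.contDiffOn_σ.fderiv_of_isOpen c.isOpen_W (by norm_num)
  have h3 : ContDiffOn ℝ 1 (fun w => areaFactor (fderiv ℝ c.σ w)) c.W := fun w hw =>
    ((contDiffAt_areaFactor (n := 1) (c.injective_fderiv_σ hw)).comp w
      (h2.contDiffAt (c.isOpen_W.mem_nhds hw))).contDiffWithinAt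
  exact h3.smul ((h1.comp hκ fun w hw => c.κ_mem_dom hw).clm_apply
    (hz.contDiffOn.comp hκ c.mapsTo_κ))

/-- In the given parameters the divergence is the pullback of the divergence in the chart. -/
lemma planeDiv_sqrtDet_smul {z : ParamPlane → ParamPlane} (hz : X.IsField z) {x : ParamPlane}
    (hx : x ∈ c.dom) : planeDiv (fun y => X.sqrtDet y • z y) x
      = |(fderiv ℝ c.T x).det| * planeDiv (c.flux z) (c.T x) := by
  have hd : ∀ y ∈ c.dom, (fderiv ℝ c.T y).det ≠ 0 := fun y hy =>
    det_ne_zero_of_injective (c.injective_fderiv_T hy)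
  have hcont : ContinuousAt (fun y => (fderiv ℝ c.T y).det) x :=
    ContinuousLinearMap.continuous_det.continuousAt.comp
      ((c.contDiffAt_T hx).continuousAt_fderiv (by norm_num))
  have hF : DifferentiableAt ℝ (c.flux z) (c.T x) :=
    ((c.contDiffOn_flux hz).contDiffAt (c.isOpen_W.mem_nhds (c.T_mem hx))).differentiableAt
      (by norm_num)
  -- the sign of the Jacobian determinant is locally constant
  obtain ⟨s, hs⟩ : ∃ s : ℝ, ∀ᶠ y in nhds x, |(fderiv ℝ c.T y).det| = s * (fderiv ℝ c.T y).det := by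
    rcases lt_or_gt_of_ne (hd x hx) with h | h
    · exact ⟨-1, (hcont.eventually (eventually_lt_nhds h)).mono fun y hy => by
        rw [abs_of_neg hy]; ring⟩
    · exact ⟨1, (hcont.eventually (eventually_gt_nhds h)).mono fun y hy => by
        rw [abs_of_pos hy]; ring⟩
  have hev : (fun y => X.sqrtDet y • z y) =ᶠ[nhds x]
      fun y => cof (fderiv ℝ c.T y) ((fun w => s • c.flux z w) (c.T y)) := by
    filter_upwards [hs, c.isOpen_dom.mem_nhds hx] with y hy hyd
    have h1 : (s • c.flux z (c.T y)) =
        fderiv ℝ c.T y ((s * areaFactor (fderiv ℝ c.σ (c.T y))) • z y) := by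
      rw [map_smul, c.fderiv_T_apply hz hyd, flux, smul_smul]
    rw [h1, cof_apply_self, smul_smul, c.sqrtDet_eq_mul hyd, hy]
    congr 1; ring
  have hsF : DifferentiableAt ℝ (fun w => s • c.flux z w) (c.T x) := hF.const_smul s
  rw [planeDiv_congr hev, planeDiv_cof_comp (c.contDiffAt_T hx) hsF,
    hs.self_of_nhds]
  have hlin : planeDiv (fun w => s • c.flux z w) (c.T x) = s * planeDiv (c.flux z) (c.T x) := by
    unfold planeDiv
    rw [Finset.mul_sum]
    refine Finset.sum_congr rfl fun i _ => ?_
    have hFi : DifferentiableAt ℝ (fun y => c.flux z y i) (c.T x) :=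
      (EuclideanSpace.proj i : ParamPlane →L[ℝ] ℝ).differentiableAt.comp (c.T x) hF
    have : (fun y => (s • c.flux z y) i) = fun y => s • (c.flux z y i) := by
      ext y; simp
    rw [this, fderiv_fun_const_smul hFi]
    simp
  rw [hlin]; ring

end AdaptedChart

end

end ClosedParametricSurface

/-! ### The area measure -/

namespace ClosedParametricSurface

noncomputable section

variable {X : ClosedParametricSurface} {D : Set AmbientSpace}

lemma aemeasurable_sqrtDet : AEMeasurable X.sqrtDet (volume.restrict X.Ω) :=
  ((contDiffOn_sqrtDet (n := 0)).continuousOn.mono X.Ω_subset_U).aemeasurable X.measurableSet_Ω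

lemma integral_da (f : ParamPlane → ℝ) :
    ∫ x, f x ∂X.da = ∫ x in X.Ω, X.sqrtDet x * f x := by
  rw [da, integral_withDensity_eq_integral_toReal_smul₀ aemeasurable_sqrtDet.ennreal_ofReal
    (Filter.Eventually.of_forall fun x => ENNReal.ofReal_lt_top)]
  refine integral_congr_ae (Filter.Eventually.of_forall fun x => ?_)
  simp only [smul_eq_mul]
  rw [ENNReal.toReal_ofReal (show 0 ≤ X.sqrtDet x from Real.sqrt_nonneg _)]

lemma integrable_da_iff (f : ParamPlane → ℝ) :
    Integrable f X.da ↔ IntegrableOn (fun x => X.sqrtDet x * f x) X.Ω := by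
  rw [da, integrable_withDensity_iff_integrable_smul₀' aemeasurable_sqrtDet.ennreal_ofReal
    (Filter.Eventually.of_forall fun x => ENNReal.ofReal_lt_top)]
  refine integrable_congr (Filter.Eventually.of_forall fun x => ?_)
  simp only [smul_eq_mul]
  rw [ENNReal.toReal_ofReal (show 0 ≤ X.sqrtDet x from Real.sqrt_nonneg _)]

lemma ae_da_mem : ∀ᵐ x ∂X.da, x ∈ X.Ω :=
  (withDensity_absolutelyContinuous _ _).ae_le (ae_restrict_mem X.measurableSet_Ω)

namespace AdaptedChart

variable (c : AdaptedChart X D)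

lemma measurableSet_inter_dom : MeasurableSet (X.Ω ∩ c.dom) :=
  X.measurableSet_Ω.inter c.isOpen_dom.measurableSet

lemma injOn_T : Set.InjOn c.T (X.Ω ∩ c.dom) := by
  intro x hx y hy hxy
  refine X.injOn hx.1 hy.1 ?_
  rw [← c.σ_T hx.2, ← c.σ_T hy.2, hxy]

lemma image_T : c.T '' (X.Ω ∩ c.dom) = c.W := by
  refine Set.Subset.antisymm ?_ fun w hw => ?_
  · rintro _ ⟨x, hx, rfl⟩; exact c.T_mem hx.2
  · obtain ⟨x, hx, hxw⟩ := X.mapsTo (c.mapsTo_κ hw)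
    refine ⟨x, ⟨hx, X.Ω_subset_U hx, ?_⟩, ?_⟩
    · rw [Set.mem_preimage, hxw]; exact c.S_κ_mem w hw
    · rw [T, hxw]; exact c.Θ_S_κ w hw

lemma hasFDerivWithinAt_T : ∀ x ∈ X.Ω ∩ c.dom,
    HasFDerivWithinAt c.T (fderiv ℝ c.T x) (X.Ω ∩ c.dom) x := fun _ hx =>
  ((c.contDiffAt_T hx.2).differentiableAt (by norm_num)).hasFDerivAt.hasFDerivWithinAt

/-- The area measure in the chart. -/
lemma lintegral_da_dom (f : ParamPlane → ENNReal) :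
    ∫⁻ x in c.dom, f (c.T x) ∂X.da
      = ∫⁻ w in c.W, ENNReal.ofReal (areaFactor (fderiv ℝ c.σ w)) * f w := by
  rw [da, setLIntegral_withDensity_eq_setLIntegral_mul_non_measurable₀ _
    (aemeasurable_sqrtDet.ennreal_ofReal.restrict) _ c.isOpen_dom.measurableSet
    (Filter.Eventually.of_forall fun x => ENNReal.ofReal_lt_top),
    Measure.restrict_restrict c.isOpen_dom.measurableSet, Set.inter_comm, ← c.image_T,
    lintegral_image_eq_lintegral_abs_det_fderiv_mul volume c.measurableSet_inter_dom
      c.hasFDerivWithinAt_T c.injOn_T]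
  refine setLIntegral_congr_fun c.measurableSet_inter_dom fun x hx => ?_
  simp only [Pi.mul_apply]
  rw [c.sqrtDet_eq_mul hx.2, ENNReal.ofReal_mul (abs_nonneg _), mul_assoc]

lemma ae_T_ne_zero : ∀ᵐ x ∂X.da, x ∈ c.dom → c.T x 0 ≠ 0 := by
  set Z : Set ParamPlane := {w | w 0 = 0} with hZ
  have hZc : IsClosed Z :=
    isClosed_eq (EuclideanSpace.proj 0 : ParamPlane →L[ℝ] ℝ).continuous continuous_const
  have hm : MeasurableSet (c.dom ∩ c.T ⁻¹' Z) := by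
    have h1 : c.dom ∩ c.T ⁻¹' Z = c.dom \ (c.dom ∩ c.T ⁻¹' Zᶜ) := by
      ext x; by_cases hx : c.T x ∈ Z <;> simp [hx]
    rw [h1]
    exact c.isOpen_dom.measurableSet.diff (c.contDiffOn_T.continuousOn.isOpen_inter_preimage
      c.isOpen_dom hZc.isOpen_compl).measurableSet
  have h2 := c.lintegral_da_dom (Z.indicator 1)
  have h3 : ∫⁻ w in c.W, ENNReal.ofReal (areaFactor (fderiv ℝ c.σ w)) * Z.indicator 1 w = 0 := by
    refine (lintegral_congr_ae (ae_restrict_of_ae ?_)).trans lintegral_zero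
    filter_upwards [ae_apply_zero_ne_zero] with w hw
    rw [Set.indicator_of_notMem (show w ∉ Z from hw), mul_zero]
  have h4 : ∫⁻ x in c.dom, Z.indicator (1 : ParamPlane → ENNReal) (c.T x) ∂X.da
      = X.da (c.dom ∩ c.T ⁻¹' Z) := by
    rw [← lintegral_indicator_one hm, ← lintegral_indicator c.isOpen_dom.measurableSet]
    refine lintegral_congr fun x => ?_
    by_cases hx : x ∈ c.dom <;> by_cases hxZ : c.T x ∈ Z <;> simp [hx, hxZ]
  rw [← h2, h4] at h3
  filter_upwards [compl_mem_ae_iff.2 h3] with x hx hxd h0 using hx ⟨hxd, h0⟩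

lemma chi_eq {x : ParamPlane} (hx : x ∈ c.dom) (h0 : c.T x 0 ≠ 0) :
    X.chi D x = if c.T x 0 < 0 then 1 else 0 := by
  unfold chi
  rcases lt_or_gt_of_ne h0 with h | h
  · rw [Set.indicator_of_mem (c.mem_of_neg x hx.1 hx.2 h), if_pos h]
  · rw [Set.indicator_of_notMem (c.notMem_of_pos x hx.1 hx.2 h), if_neg (not_lt.2 h.le)]

end AdaptedChart

/-- A `C^n` function on an open set that vanishes outside a compact subset extends by zero. -/
lemma contDiff_indicator_of_isCompact {E F : Type*} [NormedAddCommGroup E] [NormedSpace ℝ E]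
    [NormedAddCommGroup F] [NormedSpace ℝ F] {W K : Set E} {f : E → F} {n : ℕ∞}
    (hW : IsOpen W) (hf : ContDiffOn ℝ n f W) (hK : IsCompact K) (hKW : K ⊆ W)
    (h0 : ∀ w ∈ W, w ∉ K → f w = 0) :
    ContDiff ℝ n (W.indicator f) ∧ HasCompactSupport (W.indicator f) ∧
      tsupport (W.indicator f) ⊆ W := by
  have hz : ∀ w, w ∉ K → W.indicator f w = 0 := fun w hw => by
    by_cases hwW : w ∈ W
    · rw [Set.indicator_of_mem hwW, h0 w hwW hw]
    · exact Set.indicator_of_notMem hwW _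
  refine ⟨contDiff_iff_contDiffAt.2 fun w => ?_, HasCompactSupport.intro hK hz,
    (closure_minimal (fun w hw => by_contra fun h =>
      (Function.mem_support.1 hw) (hz w h)) hK.isClosed).trans hKW⟩
  by_cases hw : w ∈ K
  · refine (hf.contDiffAt (hW.mem_nhds (hKW hw))).congr_of_eventuallyEq ?_
    exact Filter.eventuallyEq_of_mem (hW.mem_nhds (hKW hw)) fun y hy => Set.indicator_of_mem hy _
  · refine (contDiffAt_const (c := (0 : F))).congr_of_eventuallyEq ?_
    exact Filter.eventuallyEq_of_mem (hK.isClosed.isOpen_compl.mem_nhds hw) fun y hy => hz y hy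

namespace AdaptedChart

variable (c : AdaptedChart X D)

/-- The closed subsets of the chart domain meet the surface in compact sets of coordinates. -/
lemma exists_isCompact_coordinates {A : Set AmbientSpace} (hA : IsClosed A) (hAO : A ⊆ c.O) :
    ∃ K ⊆ c.W, IsCompact K ∧ ∀ w ∈ c.W, w ∉ K → c.σ w ∉ A := by
  refine ⟨c.Θ '' (X.M ∩ A), ?_, ?_, ?_⟩
  · rintro _ ⟨p, ⟨hpM, hpA⟩, rfl⟩
    obtain ⟨x, hx, rfl⟩ := exists_param hpM
    exact c.Θ_mem x hx (hAO hpA)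
  · exact (X.isCompact_image.inter_right hA).image_of_continuousOn
      (c.contDiffOn_Θ.continuousOn.mono fun p hp => hAO hp.2)
  · intro w hw hwK hwA
    exact hwK ⟨c.σ w, ⟨S_mem_M (c.mapsTo_κ hw), hwA⟩, c.Θ_S_κ w hw⟩

/-- The divergence theorem for fields supported in one chart: the integral over `D` of the
divergence is the flux through the coordinate line that bounds `D`. -/
lemma integral_chi_mul_div {z : ParamPlane → ParamPlane} (hz : X.IsField z)
    {A : Set AmbientSpace} (hA : IsClosed A) (hAO : A ⊆ c.O)
    (hzA : ∀ x ∈ X.U, X.S x ∉ A → z x = 0) :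
    Integrable (fun x => X.chi D x * X.div z x) X.da ∧
      ∫ x, X.chi D x * X.div z x ∂X.da = ∫ t : ℝ, c.W.indicator (c.flux z) !₂[0, t] 0 := by
  obtain ⟨K, hKW, hK, hKA⟩ := c.exists_isCompact_coordinates hA hAO
  obtain ⟨hF, hFc, hFW⟩ := contDiff_indicator_of_isCompact (n := 1) c.isOpen_W
    (c.contDiffOn_flux hz) hK hKW (fun w hw hwK => by
      rw [flux, push, hzA _ (c.mapsTo_κ hw) (hKA w hw hwK), map_zero, smul_zero])
  set F := c.W.indicator (c.flux z) with hFdef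
  -- the density in the given parameters, and its support
  set f : ParamPlane → ℝ := fun x => X.sqrtDet x * (X.chi D x * X.div z x) with hf
  have hfd : ∀ x ∈ X.U, f x = X.chi D x * planeDiv (fun y => X.sqrtDet y • z y) x := by
    intro x hx
    have := (sqrtDet_pos hx).ne'
    simp only [hf]
    rw [div_eq]; field_simp
  have hf0 : ∀ x ∈ X.Ω \ (X.Ω ∩ c.dom), f x = 0 := by
    rintro x ⟨hx, hxd⟩
    have hxU := X.Ω_subset_U hx
    have hxA : X.S x ∉ A := fun h => hxd ⟨hx, hxU, hAO h⟩
    have hev : (fun y => X.sqrtDet y • z y) =ᶠ[nhds x] fun _ => 0 := by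
      have ho : IsOpen (X.U ∩ X.S ⁻¹' Aᶜ) :=
        X.smooth.continuousOn.isOpen_inter_preimage X.isOpen_U hA.isOpen_compl
      filter_upwards [ho.mem_nhds ⟨hxU, hxA⟩] with y hy
      rw [hzA y hy.1 hy.2, smul_zero]
    rw [hfd x hxU, planeDiv_congr hev]
    simp [planeDiv]
  set G : ParamPlane → ℝ := fun w => X.chi D (c.κ w) * planeDiv (c.flux z) w with hG
  have hfG : ∀ x ∈ X.Ω ∩ c.dom, |(fderiv ℝ c.T x).det| • G (c.T x) = f x := by
    rintro x ⟨-, hx⟩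
    have hchi : X.chi D (c.κ (c.T x)) = X.chi D x := by
      have : X.S (c.κ (c.T x)) = X.S x := c.σ_T hx
      rw [chi, chi, this]
    rw [hfd x hx.1, c.planeDiv_sqrtDet_smul hz hx, hG, smul_eq_mul]
    simp only [hchi]; ring
  have hGF : c.W.indicator G =ᵐ[volume] {w : ParamPlane | w 0 < 0}.indicator (planeDiv F) := by
    filter_upwards [ae_apply_zero_ne_zero] with w hw
    by_cases hwW : w ∈ c.W
    · have hFw : planeDiv F w = planeDiv (c.flux z) w :=
        planeDiv_congr (Filter.eventuallyEq_of_mem (c.isOpen_W.mem_nhds hwW)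
          fun y hy => Set.indicator_of_mem hy _)
      rw [Set.indicator_of_mem hwW, hG]
      simp only
      rw [c.chi_eq (c.κ_mem_dom hwW) (by rwa [c.T_κ hwW]), c.T_κ hwW, ← hFw]
      by_cases h : w 0 < 0
      · rw [Set.indicator_of_mem (show w ∈ {w : ParamPlane | w 0 < 0} from h), if_pos h, one_mul]
      · rw [Set.indicator_of_notMem (show w ∉ {w : ParamPlane | w 0 < 0} from h), if_neg h,
          zero_mul]
    · have hFw : planeDiv F w = 0 := by
        rw [planeDiv_congr (notMem_tsupport_iff_eventuallyEq.1 fun h => hwW (hFW h))]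
        simp [planeDiv]
      rw [Set.indicator_of_notMem hwW]
      by_cases h : w 0 < 0
      · rw [Set.indicator_of_mem (show w ∈ {w : ParamPlane | w 0 < 0} from h), hFw]
      · rw [Set.indicator_of_notMem (show w ∉ {w : ParamPlane | w 0 < 0} from h)]
  have hmeas : MeasurableSet {w : ParamPlane | w 0 < 0} :=
    (isOpen_lt (EuclideanSpace.proj 0 : ParamPlane →L[ℝ] ℝ).continuous
      continuous_const).measurableSet
  have hintF : Integrable (planeDiv F) := integrable_planeDiv hF hFc
  constructor
  · rw [integrable_da_iff]
    have h1 : IntegrableOn f (X.Ω ∩ c.dom) := by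
      rw [← integrableOn_congr_fun hfG c.measurableSet_inter_dom,
        ← integrableOn_image_iff_integrableOn_abs_det_fderiv_smul volume c.measurableSet_inter_dom
          c.hasFDerivWithinAt_T c.injOn_T, c.image_T,
        ← integrable_indicator_iff c.isOpen_W.measurableSet]
      exact (hintF.indicator hmeas).congr hGF.symm
    exact h1.of_forall_sdiff_eq_zero X.measurableSet_Ω hf0
  · rw [integral_da]
    change ∫ x in X.Ω, f x = _
    rw [setIntegral_eq_of_subset_of_forall_sdiff_eq_zero X.measurableSet_Ω
      Set.inter_subset_left hf0, ← setIntegral_congr_fun c.measurableSet_inter_dom hfG,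
      ← integral_image_eq_integral_abs_det_fderiv_smul volume c.measurableSet_inter_dom
          c.hasFDerivWithinAt_T c.injOn_T, c.image_T,
      ← integral_indicator c.isOpen_W.measurableSet, integral_congr_ae hGF,
      integral_indicator hmeas, setIntegral_planeDiv hF hFc]

end AdaptedChart

end

end ClosedParametricSurface

/-! ### The boundary curves -/

namespace ClosedParametricSurface

noncomputable section

variable {X : ClosedParametricSurface} {D : Set AmbientSpace}

lemma isClosed_boundary : IsClosed (X.boundary D) := isClosed_closure.inter isClosed_closure

/-- Two functionals such that one is nonpositive where the other is negative are positively
proportional. -/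
lemma exists_pos_mul_eq {E : Type*} [AddCommGroup E] [Module ℝ E]
    {f g : E →ₗ[ℝ] ℝ}
    (hf : f ≠ 0) (hg : g ≠ 0) (h : ∀ v, f v < 0 → g v ≤ 0) :
    ∃ k : ℝ, 0 < k ∧ ∀ v, g v = k * f v := by
  obtain ⟨v₀, hv₀⟩ : ∃ v, f v ≠ 0 := by
    by_contra hcon; push Not at hcon; exact hf (LinearMap.ext hcon)
  obtain ⟨a, hfa⟩ : ∃ a, f a = -1 :=
    ⟨(-(f v₀)⁻¹) • v₀, by rw [map_smul, smul_eq_mul]; field_simp⟩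
  have hker : ∀ b, f b = 0 → g b = 0 := by
    intro b hb
    by_contra hgb
    have h1 := h (a + ((1 - g a) / g b) • b) (by simp [hfa, hb])
    rw [map_add, map_smul, smul_eq_mul, div_mul_cancel₀ _ hgb] at h1
    linarith
  have hprop : ∀ v, g v = -g a * f v := by
    intro v
    have h1 := hker (v + f v • a) (by simp [hfa])
    rw [map_add, map_smul, smul_eq_mul] at h1
    linarith
  refine ⟨-g a, lt_of_le_of_ne (by linarith [h a (by linarith)]) fun h0 => hg ?_, hprop⟩
  ext v; rw [hprop v, ← h0]; simp

lemma eventually_neg_of_hasDerivAt {f : ℝ → ℝ} {d : ℝ} (hf : HasDerivAt f d 0) (h0 : f 0 = 0)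
    (hd : d < 0) : ∀ᶠ s in nhdsWithin 0 (Set.Ioi 0), f s < 0 := by
  have h1 := (hasDerivAt_iff_tendsto_slope.1 hf).mono_left
    (nhdsWithin_mono 0 fun s (hs : 0 < s) => hs.ne')
  filter_upwards [h1.eventually (eventually_lt_nhds hd), self_mem_nhdsWithin] with s hs hs0
  rw [slope_def_field, h0, sub_zero, sub_zero] at hs
  by_contra! hcon
  exact absurd hs (not_lt.2 (div_nonneg hcon (le_of_lt hs0)))

namespace AdaptedChart

variable (c : AdaptedChart X D)

/-- The boundary of `D` is the coordinate line on which the first coordinate vanishes. -/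
lemma mem_boundary_iff (hD : D ⊆ X.M) {x : ParamPlane} (hx : x ∈ c.dom) :
    X.S x ∈ X.boundary D ↔ c.T x 0 = 0 := by
  have hproj : Continuous fun w : ParamPlane => w 0 :=
    (EuclideanSpace.proj 0 : ParamPlane →L[ℝ] ℝ).continuous
  constructor
  · rintro ⟨h1, h2⟩
    have hopen : ∀ P : Set ℝ, IsOpen P → IsOpen (c.O ∩ (fun p => c.Θ p 0) ⁻¹' P) := fun P hP =>
      (hproj.comp_continuousOn c.contDiffOn_Θ.continuousOn).isOpen_inter_preimage c.isOpen_O hP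
    rcases lt_trichotomy (c.T x 0) 0 with h | h | h
    · obtain ⟨q, ⟨hqO, hq⟩, hqM, hqD⟩ := mem_closure_iff.1 h2 _ (hopen _ isOpen_Iio) ⟨hx.2, h⟩
      obtain ⟨y, hy, rfl⟩ := exists_param hqM
      exact absurd (c.mem_of_neg y hy hqO hq) hqD
    · exact h
    · obtain ⟨q, ⟨hqO, hq⟩, hqD⟩ := mem_closure_iff.1 h1 _ (hopen _ isOpen_Ioi) ⟨hx.2, h⟩
      obtain ⟨y, hy, rfl⟩ := exists_param (hD hqD)
      exact absurd hqD (c.notMem_of_pos y hy hqO hq)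
  · intro h
    -- approach the point along the first coordinate line, from both sides
    set q : ℝ → ParamPlane := fun s => !₂[s, c.T x 1] with hq
    have hqc : Continuous q := (isClosedEmbedding_horizontal _).continuous
    have hq0 : q 0 = c.T x := by
      ext i; fin_cases i
      · exact h.symm
      · rfl
    have hqW : ∀ᶠ s in nhds 0, q s ∈ c.W :=
      hqc.continuousAt.eventually (c.isOpen_W.mem_nhds (hq0 ▸ c.T_mem hx))
    have hlim : Filter.Tendsto (fun s => c.σ (q s)) (nhds 0) (nhds (X.S x)) := by
      rw [← c.σ_T hx, ← hq0]
      have h1 : ContinuousAt c.σ (q 0) := by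
        rw [hq0]; exact (c.contDiffAt_σ (c.T_mem hx)).continuousAt
      exact h1.tendsto.comp hqc.continuousAt
    have hΘ : ∀ s, q s ∈ c.W → c.Θ (c.σ (q s)) 0 = s := fun s hs => by
      have := c.Θ_S_κ _ hs
      rw [σ, this]; rfl
    constructor
    · refine mem_closure_of_tendsto (hlim.mono_left nhdsWithin_le_nhds)
        (b := nhdsWithin 0 (Set.Iio 0)) ?_
      filter_upwards [hqW.filter_mono nhdsWithin_le_nhds, self_mem_nhdsWithin] with s hs hs0
      exact c.mem_of_neg _ (c.mapsTo_κ hs) (c.S_κ_mem _ hs) (by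
        have := hΘ s hs; rw [σ] at this; rw [this]; exact hs0)
    · refine mem_closure_of_tendsto (hlim.mono_left nhdsWithin_le_nhds)
        (b := nhdsWithin 0 (Set.Ioi 0)) ?_
      filter_upwards [hqW.filter_mono nhdsWithin_le_nhds, self_mem_nhdsWithin] with s hs hs0
      exact ⟨S_mem_M (c.mapsTo_κ hs), c.notMem_of_pos _ (c.mapsTo_κ hs) (c.S_κ_mem _ hs) (by
        have := hΘ s hs; rw [σ] at this; rw [this]; exact hs0)⟩

/-- The second coordinates of the boundary points in the chart. -/
def line : Set ℝ := {t | !₂[0, t] ∈ c.W}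

/-- The boundary of `D` in the chart, as a parametrized curve. -/
def curve (t : ℝ) : AmbientSpace := c.σ !₂[0, t]

lemma isOpen_line : IsOpen c.line := c.isOpen_W.preimage (isClosedEmbedding_vertical 0).continuous

lemma hasDerivAt_curve {t : ℝ} (ht : t ∈ c.line) :
    HasDerivAt c.curve (fderiv ℝ c.σ !₂[0, t] (stdVec 1)) t :=
  ((c.contDiffAt_σ ht).differentiableAt (by norm_num)).hasFDerivAt.comp_hasDerivAt t
    (hasDerivAt_vertical 0 t)

lemma contDiffOn_curve : ContDiffOn ℝ 1 c.curve c.line := by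
  have h : ContDiff ℝ 1 fun t : ℝ => (!₂[0, t] : ParamPlane) := by
    have : (fun t : ℝ => (!₂[0, t] : ParamPlane)) = fun t => t • stdVec 1 := by
      ext t i; fin_cases i <;> simp
    rw [this]
    exact contDiff_id.smul contDiff_const
  exact (c.contDiffOn_σ.of_le (by norm_num)).comp h.contDiffOn fun t ht => ht

lemma deriv_curve_ne_zero : ∀ t ∈ c.line, deriv c.curve t ≠ 0 := by
  intro t ht
  rw [(c.hasDerivAt_curve ht).deriv]
  exact norm_pos_iff.1 (norm_stdVec_one_pos (c.injective_fderiv_σ ht))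

lemma injOn_curve : Set.InjOn c.curve c.line := by
  intro s hs t ht hst
  have h1 : c.Θ (c.curve s) = !₂[0, s] := c.Θ_S_κ _ hs
  have h2 : c.Θ (c.curve t) = !₂[0, t] := c.Θ_S_κ _ ht
  rw [hst, h2] at h1
  exact (congrArg (fun w : ParamPlane => w 1) h1).symm

lemma image_curve (hD : D ⊆ X.M) : c.curve '' c.line = X.boundary D ∩ c.O := by
  ext p; constructor
  · rintro ⟨t, ht, rfl⟩
    refine ⟨(c.mem_boundary_iff hD (c.κ_mem_dom ht)).2 ?_, c.S_κ_mem _ ht⟩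
    rw [c.T_κ ht]; rfl
  · rintro ⟨hp, hpO⟩
    have hpM : p ∈ X.M := by
      have h1 : closure D ⊆ X.M := closure_minimal hD X.isCompact_image.isClosed
      exact h1 hp.1
    obtain ⟨x, hx, rfl⟩ := exists_param hpM
    have h0 := (c.mem_boundary_iff hD ⟨hx, hpO⟩).1 hp
    have hw : (!₂[0, c.T x 1] : ParamPlane) = c.T x := by
      ext i; fin_cases i
      · exact h0.symm
      · rfl
    refine ⟨c.T x 1, ?_, ?_⟩
    · rw [line, Set.mem_ofPred_eq, hw]; exact c.T_mem ⟨hx, hpO⟩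
    · rw [curve, hw]; exact c.σ_T ⟨hx, hpO⟩

/-- Arc length integrals over the part of the boundary in a chart. -/
lemma lintegral_boundary (hD : D ⊆ X.M) {f : AmbientSpace → ENNReal} (hf : Measurable f)
    (h0 : ∀ p, p ∉ c.O → f p = 0) :
    ∫⁻ p in X.boundary D, f p ∂μH[1] = ∫⁻ t in c.line, f (c.curve t) * ‖deriv c.curve t‖ₑ := by
  rw [← lintegral_hausdorffMeasure_image_curve c.isOpen_line c.contDiffOn_curve
    c.deriv_curve_ne_zero c.injOn_curve hf, c.image_curve hD, Set.inter_comm,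
    ← Measure.restrict_restrict c.isOpen_O.measurableSet,
    ← lintegral_indicator c.isOpen_O.measurableSet]
  refine lintegral_congr fun p => ?_
  by_cases hp : p ∈ c.O
  · rw [Set.indicator_of_mem hp]
  · rw [Set.indicator_of_notMem hp, h0 p hp]

lemma integrableOn_line {ψ : AmbientSpace → ℝ} (hψ : Continuous ψ) (hψO : tsupport ψ ⊆ c.O)
    {f : ℝ → ℝ} (hf : ContinuousOn f c.line) :
    IntegrableOn (fun t => ψ (c.curve t) * f t) c.line := by
  obtain ⟨K, hKW, hK, hKA⟩ := c.exists_isCompact_coordinates (isClosed_tsupport ψ) hψO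
  have hcont : ContDiffOn ℝ (0 : ℕ∞) (fun t => ψ (c.curve t) * f t) c.line := by
    refine contDiffOn_zero.2 ?_
    exact (hψ.comp_continuousOn c.contDiffOn_curve.continuousOn).mul hf
  obtain ⟨h1, h2, -⟩ := contDiff_indicator_of_isCompact c.isOpen_line hcont
    ((isClosedEmbedding_vertical 0).isCompact_preimage hK) (fun t ht => hKW ht) (fun t ht htK => by
      have : c.curve t ∉ tsupport ψ := hKA _ ht htK
      rw [image_eq_zero_of_notMem_tsupport this, zero_mul])
  rw [← integrable_indicator_iff c.isOpen_line.measurableSet]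
  exact h1.continuous.integrable_of_hasCompactSupport h2

lemma flux_smul (ψ : AmbientSpace → ℝ) (z : ParamPlane → ParamPlane) (w : ParamPlane) :
    c.flux (fun x => ψ (X.S x) • z x) w = ψ (c.σ w) • c.flux z w := by
  simp only [flux, push, map_smul]
  rw [smul_comm]; rfl

lemma integral_indicator_flux (ψ : AmbientSpace → ℝ) (z : ParamPlane → ParamPlane) :
    ∫ t : ℝ, c.W.indicator (c.flux fun x => ψ (X.S x) • z x) !₂[0, t] 0
      = ∫ t in c.line, ψ (c.curve t) * c.flux z !₂[0, t] 0 := by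
  rw [← integral_indicator c.isOpen_line.measurableSet]
  congr 1; ext t
  by_cases ht : t ∈ c.line
  · rw [Set.indicator_of_mem (show (!₂[0, t] : ParamPlane) ∈ c.W from ht),
      Set.indicator_of_mem ht, flux_smul]
    simp [curve]
  · rw [Set.indicator_of_notMem (show (!₂[0, t] : ParamPlane) ∉ c.W from ht),
      Set.indicator_of_notMem ht]
    rfl

/-- The flux density of a field of norm at most one is at most the length element. -/
lemma flux_le {z : ParamPlane → ParamPlane} (hz : ∀ x ∈ X.U, X.normG x (z x) ≤ 1) {t : ℝ}
    (ht : t ∈ c.line) : c.flux z !₂[0, t] 0 ≤ ‖deriv c.curve t‖ := by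
  have hinj := c.injective_fderiv_σ ht
  have h1 := areaFactor_mul_le hinj (c.push z !₂[0, t])
  rw [c.fderiv_σ_push z ht, ← (c.hasDerivAt_curve ht).deriv] at h1
  have h2 : ‖X.J (c.κ !₂[0, t]) (z (c.κ !₂[0, t]))‖ ≤ 1 := hz _ (c.mapsTo_κ ht)
  calc c.flux z !₂[0, t] 0 = areaFactor (fderiv ℝ c.σ !₂[0, t]) * c.push z !₂[0, t] 0 := by
        simp [flux]
    _ ≤ _ := h1
    _ ≤ ‖deriv c.curve t‖ := mul_le_of_le_one_right (norm_nonneg _) h2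

lemma continuousOn_flux_line {z : ParamPlane → ParamPlane} (hz : X.IsField z) :
    ContinuousOn (fun t => c.flux z !₂[0, t] 0) c.line :=
  (EuclideanSpace.proj 0 : ParamPlane →L[ℝ] ℝ).continuous.comp_continuousOn
    ((c.contDiffOn_flux hz).continuousOn.comp
      (isClosedEmbedding_vertical 0).continuous.continuousOn fun _ ht => ht)

lemma continuousOn_norm_deriv_curve : ContinuousOn (fun t => ‖deriv c.curve t‖) c.line :=
  (c.contDiffOn_curve.continuousOn_deriv_of_isOpen c.isOpen_line (by norm_num)).norm

/-- The unit conormal of the first coordinate, that is the normalized gradient of the first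
coordinate function on the surface, in the given parameters. -/
def conormalField (x : ParamPlane) : ParamPlane :=
  (fderiv ℝ c.T x).inverse (conormal (fderiv ℝ c.σ (c.T x)))

lemma exists_equiv_fderiv_T {x : ParamPlane} (hx : x ∈ c.dom) :
    ∃ A : ParamPlane ≃L[ℝ] ParamPlane, (A : ParamPlane →L[ℝ] ParamPlane) = fderiv ℝ c.T x :=
  ⟨(LinearEquiv.ofInjectiveEndo (fderiv ℝ c.T x : ParamPlane →ₗ[ℝ] ParamPlane)
    (c.injective_fderiv_T hx)).toContinuousLinearEquiv, rfl⟩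

lemma fderiv_T_conormalField {x : ParamPlane} (hx : x ∈ c.dom) :
    fderiv ℝ c.T x (c.conormalField x) = conormal (fderiv ℝ c.σ (c.T x)) := by
  obtain ⟨A, hA⟩ := c.exists_equiv_fderiv_T hx
  rw [conormalField, ← hA, ContinuousLinearMap.inverse_equiv]
  simp

lemma J_conormalField {x : ParamPlane} (hx : x ∈ c.dom) :
    X.J x (c.conormalField x)
      = fderiv ℝ c.σ (c.T x) (conormal (fderiv ℝ c.σ (c.T x))) := by
  rw [c.J_eq_comp hx, ContinuousLinearMap.comp_apply, c.fderiv_T_conormalField hx]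

lemma norm_J_conormalField {x : ParamPlane} (hx : x ∈ c.dom) :
    ‖X.J x (c.conormalField x)‖ = 1 := by
  rw [c.J_conormalField hx, norm_map_conormal (c.injective_fderiv_σ (c.T_mem hx))]

/-- The conormal field is a positive multiple of the gradient of the first coordinate. -/
lemma exists_inner_J_conormalField {x : ParamPlane} (hx : x ∈ c.dom) :
    ∃ m : ℝ, 0 < m ∧ ∀ v, inner ℝ (X.J x (c.conormalField x)) (X.J x v)
      = m * fderiv ℝ c.T x v 0 := by
  have hinj := c.injective_fderiv_σ (c.T_mem hx)
  refine ⟨_, div_pos (areaFactor_pos hinj) (norm_stdVec_one_pos hinj), fun v => ?_⟩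
  rw [c.J_conormalField hx, c.J_eq_comp hx, ContinuousLinearMap.comp_apply,
    inner_map_conormal hinj]

lemma contDiffOn_conormalField : ContDiffOn ℝ 1 c.conormalField c.dom := by
  intro x hx
  have hT : ContDiffAt ℝ 1 (fderiv ℝ c.T) x := (c.contDiffAt_T hx).fderiv_right (by norm_num)
  have hσ : ContDiffAt ℝ 1 (fun y => fderiv ℝ c.σ (c.T y)) x :=
    ((c.contDiffAt_σ (c.T_mem hx)).fderiv_right (by norm_num)).comp x
      ((c.contDiffAt_T hx).of_le (by norm_num))
  obtain ⟨A, hA⟩ := c.exists_equiv_fderiv_T hx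
  have hinv : ContDiffAt ℝ 1 (fun y => (fderiv ℝ c.T y).inverse) x := by
    have h1 : ContDiffAt ℝ 1 ContinuousLinearMap.inverse (fderiv ℝ c.T x) := by
      rw [← hA]; exact contDiffAt_map_inverse A
    exact h1.comp x hT
  have hB := c.injective_fderiv_σ (c.T_mem hx)
  have hcon : ContDiffAt ℝ 1 (conormal (E := AmbientSpace)) (fderiv ℝ c.σ (c.T x)) := by
    have hv : ∀ v : ParamPlane, ContDiff ℝ 1 fun B : ParamPlane →L[ℝ] AmbientSpace => B v :=
      fun v => contDiff_id.clm_apply contDiff_const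
    have hpos := norm_stdVec_one_pos hB
    have h1 : ContDiffAt ℝ 1 (fun B : ParamPlane →L[ℝ] AmbientSpace =>
        (‖B (stdVec 1)‖ * areaFactor B)⁻¹) (fderiv ℝ c.σ (c.T x)) :=
      (((hv _).contDiffAt.norm ℝ (norm_pos_iff.1 hpos)).mul
        (contDiffAt_areaFactor (n := 1) hB)).inv (mul_pos hpos (areaFactor_pos hB)).ne'
    have h2 : ContDiff ℝ 1 (fun B : ParamPlane →L[ℝ] AmbientSpace =>
        (!₂[‖B (stdVec 1)‖ ^ 2, - inner ℝ (B (stdVec 0)) (B (stdVec 1))] : ParamPlane)) := by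
      rw [contDiff_euclidean]
      intro i
      fin_cases i
      · exact (hv _).norm_sq ℝ
      · exact ((hv _).inner ℝ (hv _)).neg
    exact h1.smul h2.contDiffAt
  exact (hinv.clm_apply (hcon.comp x hσ)).contDiffWithinAt

/-- The first components of the derivatives of two charts are positively proportional at boundary
points, because both first coordinates are negative in the interior of `D` and positive in the
exterior. -/
lemma exists_fderiv_T_zero_eq (c c' : AdaptedChart X D) {x : ParamPlane} (hx : x ∈ c.dom)
    (hx' : x ∈ c'.dom) (h0 : c.T x 0 = 0) (h0' : c'.T x 0 = 0) :
    ∃ k : ℝ, 0 < k ∧ ∀ v, fderiv ℝ c'.T x v 0 = k * fderiv ℝ c.T x v 0 := by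
  have hne : ∀ c : AdaptedChart X D, x ∈ c.dom →
      (((EuclideanSpace.proj 0 : ParamPlane →L[ℝ] ℝ).comp (fderiv ℝ c.T x) :
        ParamPlane →L[ℝ] ℝ) : ParamPlane →ₗ[ℝ] ℝ) ≠ 0 := by
    intro c hc h
    obtain ⟨A, hA⟩ := c.exists_equiv_fderiv_T hc
    have := congrArg (fun f => f (A.symm (stdVec 0))) h
    rw [← hA] at this
    simp at this
  have hder : ∀ c : AdaptedChart X D, x ∈ c.dom → ∀ v : ParamPlane,
      HasDerivAt (fun s : ℝ => c.T (x + s • v) 0) (fderiv ℝ c.T x v 0) 0 := by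
    intro c hc v
    have h1 : HasDerivAt (fun s : ℝ => x + s • v) v 0 := by
      simpa using ((hasDerivAt_id (0 : ℝ)).smul_const v).const_add x
    have h2 : HasFDerivAt c.T (fderiv ℝ c.T x) ((fun s : ℝ => x + s • v) 0) := by
      simp only [zero_smul, add_zero]
      exact ((c.contDiffAt_T hc).differentiableAt (by norm_num)).hasFDerivAt
    have h3 : HasDerivAt (fun s : ℝ => c.T (x + s • v)) (fderiv ℝ c.T x v) 0 :=
      HasFDerivAt.comp_hasDerivAt (f := fun s : ℝ => x + s • v) 0 h2 h1
    exact (EuclideanSpace.proj 0 : ParamPlane →L[ℝ] ℝ).hasFDerivAt.comp_hasDerivAt 0 h3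
  refine exists_pos_mul_eq (hne c hx) (hne c' hx') fun v hv => ?_
  change fderiv ℝ c.T x v 0 < 0 at hv
  change fderiv ℝ c'.T x v 0 ≤ 0
  by_contra! hpos
  have hline : Continuous fun s : ℝ => x + s • v := by fun_prop
  have hev : ∀ c : AdaptedChart X D, x ∈ c.dom → ∀ᶠ s : ℝ in nhdsWithin 0 (Set.Ioi 0),
      x + s • v ∈ c.dom := fun c hc =>
    (hline.continuousAt.eventually (c.isOpen_dom.mem_nhds (by simpa using hc))).filter_mono
      nhdsWithin_le_nhds
  have h1 : ∀ᶠ s : ℝ in nhdsWithin 0 (Set.Ioi 0), c.T (x + s • v) 0 < 0 :=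
    eventually_neg_of_hasDerivAt (hder c hx v) (by simpa using h0) hv
  have h2 : ∀ᶠ s : ℝ in nhdsWithin 0 (Set.Ioi 0), 0 < c'.T (x + s • v) 0 :=
    (eventually_neg_of_hasDerivAt (hder c' hx' v).neg (by simpa using h0')
      (neg_neg_of_pos hpos)).mono fun s hs => neg_neg_iff_pos.1 hs
  obtain ⟨s, hs1, hs2, hs3, hs4⟩ := (h1.and (h2.and ((hev c hx).and (hev c' hx')))).exists
  exact c'.notMem_of_pos _ hs4.1 hs4.2 hs2 (c.mem_of_neg _ hs3.1 hs3.2 hs1)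

/-- At boundary points of `D` the conormal does not depend on the chart. -/
lemma conormalField_eq (c c' : AdaptedChart X D) {x : ParamPlane} (hx : x ∈ c.dom)
    (hx' : x ∈ c'.dom) (h0 : c.T x 0 = 0) (h0' : c'.T x 0 = 0) :
    c'.conormalField x = c.conormalField x := by
  obtain ⟨k, hk, hkT⟩ := exists_fderiv_T_zero_eq c c' hx hx' h0 h0'
  obtain ⟨m, hm, hmT⟩ := c.exists_inner_J_conormalField hx
  obtain ⟨m', hm', hmT'⟩ := c'.exists_inner_J_conormalField hx'
  set r := m' * k / m with hr
  have hrpos : 0 < r := by positivity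
  have hJ : X.J x (c'.conormalField x - r • c.conormalField x) = 0 := by
    rw [← inner_self_eq_zero (𝕜 := ℝ), map_sub, inner_sub_left, map_smul, inner_smul_left]
    rw [← map_smul, ← map_sub, hmT, hmT', hkT, hr]
    simp only [conj_trivial]
    field_simp
    ring
  have h1 : c'.conormalField x = r • c.conormalField x :=
    sub_eq_zero.1 ((map_eq_zero_iff _ (X.immersion x hx.1)).1 hJ)
  have h2 := c'.norm_J_conormalField hx'
  rw [h1, map_smul, norm_smul, c.norm_J_conormalField hx, mul_one, Real.norm_eq_abs,
    abs_of_pos hrpos] at h2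
  rw [h1, h2, one_smul]

end AdaptedChart

end

end ClosedParametricSurface

/-! ### The perimeter as a total variation -/

namespace ClosedParametricSurface

noncomputable section

variable {X : ClosedParametricSurface} {D : Set AmbientSpace}

/-- A finite atlas of charts adapted to `D` with a smooth partition of unity subordinate to it. -/
structure AdaptedPartition (X : ClosedParametricSurface) (D : Set AmbientSpace) where
  /-- the indices of the charts -/
  ι : Type
  /-- the atlas is finite -/
  fintype : Fintype ι
  /-- the charts -/
  c : ι → AdaptedChart X D
  /-- the functions of the partition, defined on the ambient space -/
  ψ : ι → AmbientSpace → ℝ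
  contDiff_ψ : ∀ i, ContDiff ℝ ∞ (ψ i)
  nonneg : ∀ i p, 0 ≤ ψ i p
  tsupport_subset : ∀ i, tsupport (ψ i) ⊆ (c i).O
  sum_eq_one : ∀ p ∈ X.M, ∑ i ∈ fintype.elems, ψ i p = 1

open scoped Manifold in
lemma HasSmoothBoundary.nonempty_adaptedPartition (hD : X.HasSmoothBoundary D) :
    Nonempty (AdaptedPartition X D) := by
  classical
  have hex : ∀ p : X.M, ∃ c : AdaptedChart X D, p.1 ∈ c.O := by
    rintro ⟨p, hp⟩
    obtain ⟨x, hx, rfl⟩ := exists_param hp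
    exact hD.exists_adaptedChart hx
  choose c hc using hex
  obtain ⟨t, ht⟩ := X.isCompact_image.elim_finite_subcover (fun p : X.M => (c p).O)
    (fun p => (c p).isOpen_O) (fun p hp => Set.mem_iUnion.2 ⟨⟨p, hp⟩, hc ⟨p, hp⟩⟩)
  let e : Fin t.card ≃ t := t.equivFin.symm
  obtain ⟨f, hf⟩ := SmoothPartitionOfUnity.exists_isSubordinate 𝓘(ℝ, AmbientSpace)
    X.isCompact_image.isClosed (fun i : Fin t.card => (c (e i)).O) (fun i => (c (e i)).isOpen_O)
    (fun p hp => by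
      obtain ⟨q, hq, hpq⟩ := Set.mem_iUnion₂.1 (ht hp)
      refine Set.mem_iUnion.2 ⟨e.symm ⟨q, hq⟩, ?_⟩
      simpa using hpq)
  exact ⟨{
    ι := Fin t.card
    fintype := inferInstance
    c := fun i => c (e i)
    ψ := fun i => f i
    contDiff_ψ := fun i => (f i).contMDiff.contDiff
    nonneg := fun i p => f.nonneg i p
    tsupport_subset := fun i => hf i
    sum_eq_one := fun p hp => by
      rw [← f.sum_eq_one hp, finsum_eq_sum_of_fintype]; rfl }⟩

lemma IsField.smul {z : ParamPlane → ParamPlane} (hz : X.IsField z) {ψ : AmbientSpace → ℝ}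
    (hψ : ContDiff ℝ ∞ ψ) : X.IsField fun x => ψ (X.S x) • z x where
  contDiffOn := ((hψ.of_le (by norm_cast)).comp_contDiffOn
    (X.smooth.of_le (by norm_cast))).smul hz.contDiffOn
  compatible := fun x hx y hy hxy => by
    rw [map_smul, map_smul, hz.compatible x hx y hy hxy, hxy]

namespace AdaptedPartition

variable (P : AdaptedPartition X D)

instance : Fintype P.ι := P.fintype

lemma sum_ψ {p : AmbientSpace} (hp : p ∈ X.M) : ∑ i, P.ψ i p = 1 := P.sum_eq_one p hp

lemma div_eq_sum {z : ParamPlane → ParamPlane} (hz : X.IsField z) {x : ParamPlane}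
    (hx : x ∈ X.U) : X.div z x = ∑ i, X.div (fun y => P.ψ i (X.S y) • z y) x := by
  unfold div
  rw [← Finset.mul_sum, Finset.sum_comm]
  congr 1
  refine Finset.sum_congr rfl fun k _ => ?_
  have hd : ∀ i, DifferentiableAt ℝ
      (fun y => X.sqrtDet y * (P.ψ i (X.S y) • z y) k) x := by
    intro i
    have h1 : DifferentiableAt ℝ (fun y => P.ψ i (X.S y) • z y) x :=
      ((hz.smul (P.contDiff_ψ i)).contDiffOn.contDiffAt
        (X.isOpen_U.mem_nhds hx)).differentiableAt (by norm_num)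
    have h2 : DifferentiableAt ℝ X.sqrtDet x :=
      ((contDiffOn_sqrtDet (n := 1)).contDiffAt
        (X.isOpen_U.mem_nhds hx)).differentiableAt (by norm_num)
    exact h2.mul ((EuclideanSpace.proj k : ParamPlane →L[ℝ] ℝ).differentiableAt.comp x h1)
  have hev : (fun y => X.sqrtDet y * z y k) =ᶠ[nhds x]
      fun y => ∑ i, X.sqrtDet y * (P.ψ i (X.S y) • z y) k := by
    filter_upwards [X.isOpen_U.mem_nhds hx] with y hy
    simp only [PiLp.smul_apply, smul_eq_mul]
    rw [← Finset.mul_sum, ← Finset.sum_mul, P.sum_ψ (S_mem_M hy), one_mul]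
  rw [hev.fderiv_eq, fderiv_fun_sum fun i _ => hd i]
  simp

/-- The divergence theorem on `D`, with the boundary flux expressed in the charts. -/
lemma integral_chi_mul_div {z : ParamPlane → ParamPlane} (hz : X.IsField z) :
    Integrable (fun x => X.chi D x * X.div z x) X.da ∧
      ∫ x, X.chi D x * X.div z x ∂X.da = ∑ i, ∫ t in (P.c i).line,
        P.ψ i ((P.c i).curve t) * (P.c i).flux z !₂[0, t] 0 := by
  have hloc := fun i => (P.c i).integral_chi_mul_div (hz.smul (P.contDiff_ψ i))
    (isClosed_tsupport (P.ψ i)) (P.tsupport_subset i) (fun x _ hxs => by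
      rw [image_eq_zero_of_notMem_tsupport hxs, zero_smul])
  have hsum : (fun x => X.chi D x * X.div z x) =ᵐ[X.da]
      fun x => ∑ i, X.chi D x * X.div (fun y => P.ψ i (X.S y) • z y) x := by
    filter_upwards [ae_da_mem] with x hx
    rw [P.div_eq_sum hz (X.Ω_subset_U hx), Finset.mul_sum]
  refine ⟨(integrable_finsetSum _ fun i _ => (hloc i).1).congr hsum.symm, ?_⟩
  rw [integral_congr_ae hsum, integral_finsetSum _ fun i _ => (hloc i).1]
  exact Finset.sum_congr rfl fun i _ => (hloc i).2.trans ((P.c i).integral_indicator_flux _ _)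

/-- The length of the boundary of `D`, computed in the charts. -/
def length : ℝ :=
  ∑ i, ∫ t in (P.c i).line, P.ψ i ((P.c i).curve t) * ‖deriv (P.c i).curve t‖

lemma integrableOn_length (i : P.ι) : IntegrableOn
    (fun t => P.ψ i ((P.c i).curve t) * ‖deriv (P.c i).curve t‖) (P.c i).line :=
  (P.c i).integrableOn_line (P.contDiff_ψ i).continuous (P.tsupport_subset i)
    (P.c i).continuousOn_norm_deriv_curve

lemma per_eq (hD : D ⊆ X.M) : X.per D = ENNReal.ofReal P.length := by
  have hbM : X.boundary D ⊆ X.M := fun p hp =>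
    (closure_minimal hD X.isCompact_image.isClosed) hp.1
  have hnn : ∀ i t, 0 ≤ P.ψ i ((P.c i).curve t) * ‖deriv (P.c i).curve t‖ := fun i t =>
    mul_nonneg (P.nonneg i _) (norm_nonneg _)
  have hm : ∀ i, Measurable fun p => ENNReal.ofReal (P.ψ i p) := fun i =>
    (P.contDiff_ψ i).continuous.measurable.ennreal_ofReal
  have h1 : X.per D = ∫⁻ p in X.boundary D, ∑ i, ENNReal.ofReal (P.ψ i p) ∂μH[1] := by
    rw [per, ← setLIntegral_one]
    refine setLIntegral_congr_fun isClosed_boundary.measurableSet fun p hp => ?_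
    rw [← ENNReal.ofReal_sum_of_nonneg fun i _ => P.nonneg i p, P.sum_ψ (hbM hp),
      ENNReal.ofReal_one]
  rw [h1, lintegral_finsetSum _ fun i _ => hm i, length,
    ENNReal.ofReal_sum_of_nonneg fun i _ => integral_nonneg fun t => hnn i t]
  refine Finset.sum_congr rfl fun i _ => ?_
  rw [(P.c i).lintegral_boundary hD (hm i) (fun p hp => by
    rw [image_eq_zero_of_notMem_tsupport fun h => hp (P.tsupport_subset i h), ENNReal.ofReal_zero]),
    ofReal_integral_eq_lintegral_ofReal (P.integrableOn_length i)
      (Filter.Eventually.of_forall fun t => hnn i t)]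
  refine lintegral_congr fun t => ?_
  rw [ENNReal.ofReal_mul (P.nonneg i _), ofReal_norm]

/-- A global field that equals the outer unit conormal on the boundary of `D`. -/
def normalField (x : ParamPlane) : ParamPlane :=
  ∑ i, P.ψ i (X.S x) • (P.c i).conormalField x

lemma ψ_eq_zero {i : P.ι} {x : ParamPlane} (hx : x ∈ X.U) (hxd : x ∉ (P.c i).dom) :
    P.ψ i (X.S x) = 0 :=
  image_eq_zero_of_notMem_tsupport fun h => hxd ⟨hx, P.tsupport_subset i h⟩

lemma isField_normalField : X.IsField P.normalField where
  contDiffOn := by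
    refine ContDiffOn.sum fun i _ x hx => ?_
    by_cases hxt : X.S x ∈ tsupport (P.ψ i)
    · have hxd : x ∈ (P.c i).dom := ⟨hx, P.tsupport_subset i hxt⟩
      have h1 : ContDiffAt ℝ 1 (fun y => P.ψ i (X.S y)) x :=
        ((P.contDiff_ψ i).of_le (by norm_cast)).contDiffAt.comp x
          ((X.smooth.contDiffAt (X.isOpen_U.mem_nhds hx)).of_le (by norm_cast))
      exact (h1.smul ((P.c i).contDiffOn_conormalField.contDiffAt
        ((P.c i).isOpen_dom.mem_nhds hxd))).contDiffWithinAt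
    · have ho : IsOpen (X.U ∩ X.S ⁻¹' (tsupport (P.ψ i))ᶜ) :=
        X.smooth.continuousOn.isOpen_inter_preimage X.isOpen_U (isClosed_tsupport _).isOpen_compl
      refine (contDiffAt_const (c := (0 : ParamPlane))).congr_of_eventuallyEq ?_ |>.contDiffWithinAt
      filter_upwards [ho.mem_nhds ⟨hx, hxt⟩] with y hy
      rw [image_eq_zero_of_notMem_tsupport hy.2, zero_smul]
  compatible := fun x hx y hy hxy => by
    simp only [normalField, map_sum, map_smul]
    refine Finset.sum_congr rfl fun i _ => ?_
    by_cases hxd : x ∈ (P.c i).dom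
    · have hyd : y ∈ (P.c i).dom := ⟨hy, by rw [Set.mem_preimage, ← hxy]; exact hxd.2⟩
      have hT : (P.c i).T x = (P.c i).T y := by rw [AdaptedChart.T, AdaptedChart.T, hxy]
      rw [(P.c i).J_conormalField hxd, (P.c i).J_conormalField hyd, hT, hxy]
    · rw [← hxy, P.ψ_eq_zero hx hxd, zero_smul, zero_smul]

lemma normG_normalField_le {x : ParamPlane} (hx : x ∈ X.U) :
    X.normG x (P.normalField x) ≤ 1 := by
  rw [normG, normalField, map_sum, ← P.sum_ψ (S_mem_M hx)]
  refine norm_sum_le_of_le _ fun i _ => ?_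
  by_cases hxd : x ∈ (P.c i).dom
  · rw [map_smul, norm_smul, (P.c i).norm_J_conormalField hxd, mul_one, Real.norm_eq_abs,
      abs_of_nonneg (P.nonneg i _)]
  · rw [P.ψ_eq_zero hx hxd]; simp

lemma normalField_eq (hD : D ⊆ X.M) (i : P.ι) {x : ParamPlane} (hx : x ∈ (P.c i).dom)
    (h0 : (P.c i).T x 0 = 0) : P.normalField x = (P.c i).conormalField x := by
  have h1 : ∀ j, P.ψ j (X.S x) • (P.c j).conormalField x
      = P.ψ j (X.S x) • (P.c i).conormalField x := by
    intro j
    by_cases hxd : x ∈ (P.c j).dom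
    · have h0' := ((P.c j).mem_boundary_iff hD hxd).1 (((P.c i).mem_boundary_iff hD hx).2 h0)
      rw [AdaptedChart.conormalField_eq (P.c i) (P.c j) hx hxd h0 h0']
    · rw [P.ψ_eq_zero hx.1 hxd, zero_smul, zero_smul]
  rw [normalField, Finset.sum_congr rfl fun j _ => h1 j, ← Finset.sum_smul,
    P.sum_ψ (S_mem_M hx.1), one_smul]

lemma flux_normalField (hD : D ⊆ X.M) (i : P.ι) {t : ℝ} (ht : t ∈ (P.c i).line) :
    (P.c i).flux P.normalField !₂[0, t] 0 = ‖deriv (P.c i).curve t‖ := by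
  have hd := (P.c i).κ_mem_dom ht
  have hT := (P.c i).T_κ ht
  rw [AdaptedChart.flux, AdaptedChart.push, P.normalField_eq hD i hd (by rw [hT]; rfl),
    (P.c i).fderiv_T_conormalField hd, hT, PiLp.smul_apply, smul_eq_mul,
    areaFactor_mul_conormal ((P.c i).injective_fderiv_σ ht), ((P.c i).hasDerivAt_curve ht).deriv]

/-- The total variation of the indicator function is the length of the boundary: the flux of a
field of norm at most one is at most the length, and the normal field attains it. -/
lemma NETV_chi_eq (hD : D ⊆ X.M) : X.NETV (X.chi D) = (P.length : EReal) := by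
  refine le_antisymm (iSup₂_le fun z hz => ?_) ?_
  · rw [EReal.coe_le_coe_iff, (P.integral_chi_mul_div hz.1).2, length]
    refine Finset.sum_le_sum fun i _ => setIntegral_mono_on ?_ (P.integrableOn_length i)
      (P.c i).isOpen_line.measurableSet fun t ht =>
        mul_le_mul_of_nonneg_left ((P.c i).flux_le hz.2 ht) (P.nonneg i _)
    exact (P.c i).integrableOn_line (P.contDiff_ψ i).continuous (P.tsupport_subset i)
      ((P.c i).continuousOn_flux_line hz.1)
  · refine le_iSup₂_of_le P.normalField
      ⟨P.isField_normalField, fun x hx => P.normG_normalField_le hx⟩ ?_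
    rw [EReal.coe_le_coe_iff, (P.integral_chi_mul_div P.isField_normalField).2, length]
    refine le_of_eq (Finset.sum_congr rfl fun i _ =>
      setIntegral_congr_fun (P.c i).isOpen_line.measurableSet fun t ht => ?_)
    simp only [P.flux_normalField hD i ht]

lemma length_nonneg : 0 ≤ P.length :=
  Finset.sum_nonneg fun i _ => integral_nonneg fun _ =>
    mul_nonneg (P.nonneg i _) (norm_nonneg _)

end AdaptedPartition

lemma HasSmoothBoundary.NETV_chi (hD : X.HasSmoothBoundary D) :
    X.NETV (X.chi D) = (X.per D : EReal) := by
  obtain ⟨P⟩ := hD.nonempty_adaptedPartition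
  rw [P.NETV_chi_eq hD.subset, P.per_eq hD.subset, EReal.coe_ennreal_ofReal,
    max_eq_left P.length_nonneg]

lemma HasSmoothBoundary.integrable_chi_mul_div (hD : X.HasSmoothBoundary D)
    {z : ParamPlane → ParamPlane} (hz : X.IsField z) :
    Integrable (fun x => X.chi D x * X.div z x) X.da := by
  obtain ⟨P⟩ := hD.nonempty_adaptedPartition
  exact (P.integral_chi_mul_div hz).1

/-- The boundary of `D` has area zero, so that `D` is measurable up to a null set. -/
lemma HasSmoothBoundary.exists_measurableSet (hD : X.HasSmoothBoundary D) :
    ∃ A : Set ParamPlane, MeasurableSet A ∧ ∀ᵐ x ∂X.da, X.S x ∈ D ↔ x ∈ A := by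
  obtain ⟨P⟩ := hD.nonempty_adaptedPartition
  refine ⟨⋃ i, (P.c i).dom ∩ (P.c i).T ⁻¹' {w | w 0 < 0}, ?_, ?_⟩
  · refine MeasurableSet.iUnion fun i => IsOpen.measurableSet ?_
    exact (P.c i).contDiffOn_T.continuousOn.isOpen_inter_preimage (P.c i).isOpen_dom
      (isOpen_lt (EuclideanSpace.proj 0 : ParamPlane →L[ℝ] ℝ).continuous continuous_const)
  · filter_upwards [ae_da_mem, ae_all_iff.2 fun i => (P.c i).ae_T_ne_zero] with x hx hx0
    have hxU := X.Ω_subset_U hx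
    constructor
    · intro hxD
      obtain ⟨i, -, hi⟩ : ∃ i ∈ Finset.univ, P.ψ i (X.S x) ≠ 0 :=
        Finset.exists_ne_zero_of_sum_ne_zero (by rw [P.sum_ψ (S_mem_M hxU)]; exact one_ne_zero)
      have hxd : x ∈ (P.c i).dom := by_contra fun h => hi (P.ψ_eq_zero hxU h)
      refine Set.mem_iUnion.2 ⟨i, hxd, ?_⟩
      rcases lt_or_gt_of_ne (hx0 i hxd) with h | h
      · exact h
      · exact absurd hxD ((P.c i).notMem_of_pos x hxU hxd.2 h)
    · intro hxA
      obtain ⟨i, hxd, h⟩ := Set.mem_iUnion.1 hxA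
      exact (P.c i).mem_of_neg x hxU hxd.2 h

end

end ClosedParametricSurface

/-! ### Eigensets -/

namespace ClosedParametricSurface

noncomputable section

variable {X : ClosedParametricSurface} {C D : Set AmbientSpace}

lemma boundary_M : X.boundary X.M = ∅ := by simp [boundary]

lemma hasSmoothBoundary_M : X.HasSmoothBoundary X.M where
  subset := subset_rfl
  exists_defining := fun x _ hx => by rw [boundary_M] at hx; exact hx.elim

lemma chi_of_mem {x : ParamPlane} (hx : X.S x ∈ D) : X.chi D x = 1 := Set.indicator_of_mem hx _

lemma chi_of_notMem {x : ParamPlane} (hx : X.S x ∉ D) : X.chi D x = 0 :=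
  Set.indicator_of_notMem hx _

lemma chi_sdiff {x : ParamPlane} (hx : x ∈ X.Ω) : X.chi (X.M \ D) x = 1 - X.chi D x := by
  by_cases h : X.S x ∈ D
  · rw [chi_of_mem h, chi_of_notMem fun h' => h'.2 h, sub_self]
  · rw [chi_of_notMem h, chi_of_mem (show X.S x ∈ X.M \ D from ⟨⟨x, hx, rfl⟩, h⟩), sub_zero]

lemma div_neg (z : ParamPlane → ParamPlane) (x : ParamPlane) :
    X.div (fun y => -z y) x = -X.div z x := by
  simp only [div, PiLp.neg_apply, mul_neg, fderiv_fun_neg, _root_.neg_apply, Finset.sum_neg_distrib]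

lemma ae_chi_M : ∀ᵐ x ∂X.da, X.chi X.M x = 1 := by
  filter_upwards [ae_da_mem] with x hx using chi_of_mem ⟨x, hx, rfl⟩

lemma integrable_div {z : ParamPlane → ParamPlane} (hz : X.IsField z) :
    Integrable (X.div z) X.da := by
  refine (hasSmoothBoundary_M.integrable_chi_mul_div hz).congr ?_
  filter_upwards [ae_chi_M] with x hx
  rw [hx, one_mul]

/-- The divergence theorem on the closed surface, for fields of norm at most one. -/
lemma integral_div_eq_zero {z : ParamPlane → ParamPlane} (hz : X.IsField z)
    (hz1 : ∀ x ∈ X.U, X.normG x (z x) ≤ 1) : ∫ x, X.div z x ∂X.da = 0 := by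
  have hper : X.NETV (X.chi X.M) = ((0 : ℝ) : EReal) := by
    rw [hasSmoothBoundary_M.NETV_chi, per, boundary_M, measure_empty]; rfl
  have key : ∀ z : ParamPlane → ParamPlane, X.IsField z → (∀ x ∈ X.U, X.normG x (z x) ≤ 1) →
      ∫ x, X.div z x ∂X.da ≤ 0 := by
    intro z hz hz1
    have h1 : ((∫ x, X.chi X.M x * X.div z x ∂X.da : ℝ) : EReal) ≤ X.NETV (X.chi X.M) :=
      le_iSup₂_of_le z ⟨hz, hz1⟩ le_rfl
    rw [hper, EReal.coe_le_coe_iff] at h1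
    refine (integral_congr_ae ?_).trans_le h1
    filter_upwards [ae_chi_M] with x hx
    rw [hx, one_mul]
  refine le_antisymm (key z hz hz1) ?_
  have h2 := key (fun x => -z x) ⟨hz.contDiffOn.neg, fun x hx y hy hxy => by
      rw [map_neg, map_neg, hz.compatible x hx y hy hxy]⟩
    (fun x hx => by rw [normG, map_neg, norm_neg]; exact hz1 x hx)
  simp only [div_neg, integral_neg] at h2
  linarith

/-- The function `χ^C - β χ^{M ∖ C}` equals `(1 + β) χ^C - β`, and its total variation is
`1 + β` times that of `χ^C`, as constants do not contribute to the total variation. -/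
lemma HasSmoothBoundary.NETV_chi_eq_of_NETV_eq (hC : X.HasSmoothBoundary C) {β k : ℝ} (hβ : 0 < β)
    (hk : X.NETV (fun x => X.chi C x - β * X.chi (X.M \ C) x) = (k : EReal)) :
    X.NETV (X.chi C) = ((k / (1 + β) : ℝ) : EReal) := by
  have hβ1 : 0 < 1 + β := by linarith
  have hint : ∀ z : ParamPlane → ParamPlane, X.IsField z → (∀ x ∈ X.U, X.normG x (z x) ≤ 1) →
      ∫ x, (X.chi C x - β * X.chi (X.M \ C) x) * X.div z x ∂X.da
        = (1 + β) * ∫ x, X.chi C x * X.div z x ∂X.da := by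
    intro z hz hz1
    have h1 : (fun x => (X.chi C x - β * X.chi (X.M \ C) x) * X.div z x) =ᵐ[X.da]
        fun x => (1 + β) * (X.chi C x * X.div z x) - β * X.div z x := by
      filter_upwards [ae_da_mem] with x hx
      rw [chi_sdiff hx]; ring
    rw [integral_congr_ae h1, integral_sub ((hC.integrable_chi_mul_div hz).const_mul _)
      ((integrable_div hz).const_mul _), integral_const_mul, integral_const_mul,
      integral_div_eq_zero hz hz1, mul_zero, sub_zero]
  refine le_antisymm (iSup₂_le fun z hz => ?_) ?_
  · have h1 : ((∫ x, (X.chi C x - β * X.chi (X.M \ C) x) * X.div z x ∂X.da : ℝ) : EReal)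
        ≤ X.NETV (fun x => X.chi C x - β * X.chi (X.M \ C) x) := le_iSup₂_of_le z hz le_rfl
    rw [hk, EReal.coe_le_coe_iff, hint z hz.1 hz.2] at h1
    rw [EReal.coe_le_coe_iff, le_div_iff₀ hβ1]
    linarith
  · obtain ⟨P⟩ := hC.nonempty_adaptedPartition
    have hl := P.NETV_chi_eq hC.subset
    rw [hl, EReal.coe_le_coe_iff, div_le_iff₀ hβ1, ← EReal.coe_le_coe_iff, ← hk]
    refine iSup₂_le fun z hz => ?_
    have h1 : ((∫ x, X.chi C x * X.div z x ∂X.da : ℝ) : EReal) ≤ X.NETV (X.chi C) :=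
      le_iSup₂_of_le z hz le_rfl
    rw [hl, EReal.coe_le_coe_iff] at h1
    rw [EReal.coe_le_coe_iff, hint z hz.1 hz.2]
    nlinarith

lemma HasSmoothBoundary.integrable_chi [IsFiniteMeasure X.da] (hD : X.HasSmoothBoundary D) :
    MemLp (X.chi D) 2 X.da ∧ Integrable (X.chi D) X.da := by
  obtain ⟨A, hA, hDA⟩ := hD.exists_measurableSet
  have h1 : A.indicator (fun _ => (1 : ℝ)) =ᵐ[X.da] X.chi D := by
    filter_upwards [hDA] with x hx
    by_cases h : X.S x ∈ D
    · rw [chi_of_mem h, Set.indicator_of_mem (hx.1 h)]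
    · rw [chi_of_notMem h, Set.indicator_of_notMem fun h' => h (hx.2 h')]
  have h2 : MemLp (A.indicator fun _ => (1 : ℝ)) 2 X.da := (memLp_const 1).indicator hA
  have h3 : Integrable (A.indicator fun _ => (1 : ℝ)) X.da := (integrable_const 1).indicator hA
  exact ⟨h2.ae_eq h1, h3.congr h1⟩

lemma HasSmoothBoundary.area_sdiff [IsFiniteMeasure X.da] (hD : X.HasSmoothBoundary D) :
    X.area (X.M \ D) = ENNReal.ofReal (X.da.real Set.univ - ∫ x, X.chi D x ∂X.da) := by
  obtain ⟨A, hA, hDA⟩ := hD.exists_measurableSet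
  have h1 : X.chi D =ᵐ[X.da] A.indicator 1 := by
    filter_upwards [hDA] with x hx
    by_cases h : X.S x ∈ D
    · rw [chi_of_mem h, Set.indicator_of_mem (hx.1 h), Pi.one_apply]
    · rw [chi_of_notMem h, Set.indicator_of_notMem fun h' => h (hx.2 h')]
  have h2 : (X.S ⁻¹' (X.M \ D) : Set ParamPlane) =ᵐ[X.da] (Aᶜ : Set ParamPlane) := by
    filter_upwards [hDA, ae_da_mem] with x hx hxΩ
    refine propext ⟨fun h hxA => h.2 (hx.2 hxA), fun h => ⟨⟨x, hxΩ, rfl⟩, fun h' => h (hx.1 h')⟩⟩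
  rw [area, measure_congr h2, integral_congr_ae h1, integral_indicator_one hA,
    ← measureReal_compl hA, ofReal_measureReal]

/-- The algebra behind the minimality of eigensets. The perimeter of `C` is
`lam * β * |M \ C|`, and testing the subgradient inequality with the indicator function of `D`
bounds `lam * β * |M \ D|` by the perimeter of `D`. -/
lemma IsEigenset.per_le (hE : X.IsEigenset C) (hC : X.HasSmoothBoundary C)
    (hD : X.HasSmoothBoundary D) (hCD : C ⊆ D) (hpos : 0 < X.area (X.M \ D)) :
    X.per C ≤ X.area (X.M \ C) / X.area (X.M \ D) * X.per D := by
  obtain ⟨β, hβ, lam, ξ, hsub, hξ⟩ := hE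
  have hNC := hC.NETV_chi_eq_of_NETV_eq hβ hsub.eq_NETV
  obtain ⟨PC⟩ := hC.nonempty_adaptedPartition
  obtain ⟨PD⟩ := hD.nonempty_adaptedPartition
  rw [PC.NETV_chi_eq hC.subset, EReal.coe_eq_coe_iff] at hNC
  rw [PC.per_eq hC.subset, PD.per_eq hD.subset, hNC]
  rcases eq_or_ne lam 0 with rfl | hlam
  · simp
  set u : ParamPlane → ℝ := fun x => X.chi C x - β * X.chi (X.M \ C) x with hu
  have hu' : ∀ᵐ x ∂X.da, u x = (1 + β) * X.chi C x - β := by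
    filter_upwards [ae_da_mem] with x hx
    simp only [hu]
    rw [chi_sdiff hx]; ring
  -- a nonzero multiple of `u` is square integrable and bounded away from zero
  have hfin : IsFiniteMeasure X.da := by
    have hm : 0 < |lam| * min 1 β := mul_pos (abs_pos.2 hlam) (lt_min one_pos hβ)
    have h1 : MemLp (fun _ : ParamPlane => |lam| * min 1 β) 2 X.da := by
      refine hsub.memLp.mono aestronglyMeasurable_const ?_
      filter_upwards [hu'] with x hx
      rw [Real.norm_eq_abs, abs_of_pos hm, hx, norm_mul, Real.norm_eq_abs, Real.norm_eq_abs]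
      refine mul_le_mul_of_nonneg_left ?_ (abs_nonneg _)
      by_cases h : X.S x ∈ C
      · rw [chi_of_mem h]; simp
      · rw [chi_of_notMem h]; simp [abs_of_pos hβ]
    rw [memLp_const_iff (by norm_num) (by norm_num)] at h1
    exact ⟨h1.resolve_left hm.ne'⟩
  obtain ⟨-, hiC⟩ := hC.integrable_chi
  obtain ⟨hLD, hiD⟩ := hD.integrable_chi
  set a := ∫ x, X.chi C x ∂X.da with ha
  set d := ∫ x, X.chi D x ∂X.da with hd
  set m := X.da.real Set.univ with hm
  -- the mean of `u` vanishes, as `u` is a weak divergence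
  have hmean : lam * ((1 + β) * a - β * m) = 0 := by
    have h1 := hξ.integral_eq (fun _ => 1) ⟨contDiffOn_const, fun _ _ _ _ _ => rfl⟩
    simp only [fderiv_fun_const, Pi.zero_apply, zero_apply, integral_zero, mul_one] at h1
    have h2 : (fun x => lam * u x) =ᵐ[X.da] fun x => lam * ((1 + β) * X.chi C x - β) := by
      filter_upwards [hu'] with x hx; rw [hx]
    rw [integral_congr_ae h2, integral_const_mul, integral_sub (hiC.const_mul _)
      (integrable_const _), integral_const_mul, integral_const, smul_eq_mul] at h1
    linarith
  have hmean' : (1 + β) * a = β * m := by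
    have := (mul_eq_zero.1 hmean).resolve_left hlam; linarith
  have hk : ∫ x, lam * u x * u x ∂X.da = lam * ((1 + β) * a) := by
    have h2 : (fun x => lam * u x * u x) =ᵐ[X.da]
        fun x => lam * ((1 - β ^ 2) * X.chi C x + β ^ 2) := by
      filter_upwards [hu'] with x hx
      rw [hx]
      by_cases h : X.S x ∈ C
      · rw [chi_of_mem h]; ring
      · rw [chi_of_notMem h]; ring
    rw [integral_congr_ae h2, integral_const_mul, integral_add (hiC.const_mul _)
      (integrable_const _), integral_const_mul, integral_const, smul_eq_mul]
    linear_combination (-lam * β) * hmean'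
  have hD1 : lam * (β * (m - d)) ≤ PD.length := by
    have h1 := hsub.le_NETV _ hLD
    rw [PD.NETV_chi_eq hD.subset, EReal.coe_le_coe_iff] at h1
    have h2 : (fun x => lam * u x * X.chi D x) =ᵐ[X.da]
        fun x => lam * ((1 + β) * X.chi C x - β * X.chi D x) := by
      filter_upwards [hu'] with x hx
      rw [hx]
      by_cases h : X.S x ∈ C
      · rw [chi_of_mem h, chi_of_mem (hCD h)]; ring
      · rw [chi_of_notMem h]; ring
    rw [integral_congr_ae h2, integral_const_mul, integral_sub (hiC.const_mul _)
      (hiD.const_mul _), integral_const_mul, integral_const_mul] at h1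
    linear_combination h1 - lam * hmean'
  rw [hk, hC.area_sdiff, hD.area_sdiff]
  rw [hD.area_sdiff, ENNReal.ofReal_pos] at hpos
  have hCm : 0 ≤ m - a := by
    have h1 : β * (m - a) = a := by linarith
    have h2 : 0 ≤ a := integral_nonneg fun x => Set.indicator_nonneg (fun _ _ => zero_le_one) _
    exact nonneg_of_mul_nonneg_right (by rw [h1]; exact h2) hβ
  change 0 < m - d at hpos
  have hne := hpos.ne'
  rw [← ENNReal.ofReal_div_of_pos hpos, ← ENNReal.ofReal_mul (div_nonneg hCm hpos.le)]
  refine ENNReal.ofReal_le_ofReal ?_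
  calc lam * ((1 + β) * a) / (1 + β) = lam * (β * (m - a)) := by
        field_simp; linear_combination hmean'
    _ = (m - a) / (m - d) * (lam * (β * (m - d))) := by field_simp
    _ ≤ (m - a) / (m - d) * PD.length := by gcongr

end

end ClosedParametricSurface

theorem mainTheorem2 (X : ClosedParametricSurface) (C : Set AmbientSpace)
    (hC : X.HasSmoothBoundary C) (hE : X.IsEigenset C) :
    (X.per C : EReal) = X.NETV (X.chi C) ∧
    (∀ D : Set AmbientSpace, X.HasSmoothBoundary D → C ⊆ D → 0 < X.area (X.M \ D) →
      X.NETV (X.chi C) ≤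
        ((X.area (X.M \ C) / X.area (X.M \ D) : ENNReal) : EReal) * X.NETV (X.chi D) ∧
      X.NETV (X.chi D) = (X.per D : EReal) ∧
      X.per C ≤ X.area (X.M \ C) / X.area (X.M \ D) * X.per D) ∧
    ((X.boundary C).Nonempty → X.IsLocallyMinimalPerimeterSet C) := by
  refine ⟨hC.NETV_chi.symm, fun D hD hCD hpos => ⟨?_, hD.NETV_chi, hE.per_le hC hD hCD hpos⟩,
    fun hne => ⟨hne, fun D hD hCD hpos => hE.per_le hC hD hCD hpos⟩⟩
  rw [hC.NETV_chi, hD.NETV_chi, ← EReal.coe_ennreal_mul, EReal.coe_ennreal_le_coe_ennreal_iff]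
  exact hE.per_le hC hD hCD hpos
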